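/- **Setting.** Let $\mathcal G=(\mathcal V,\mathcal E)$ be a finite connected undirected graph with $N$ nodes, neighbourhoods $\mathcal N_i$, degrees $d_i$ and maximum degree $d_M$. Let $f_i:\mathbb R^n\times\mathbb R_+\to\mathbb R$ ($i\in\mathcal V$) be such that, for all $t\ge 0$, $f_i(\cdot;t)$ is $\mu$-strongly convex ($\mu>0$) with $L$-Lipschitz gradient, the derivatives $\nabla_{xx}f_i$ and $\nabla_{tx}f_i$ exist, and $\|\nabla_{tx}f_i(x;t)\|\le C_0$ for all $x\in\mathbb R^n$. Put $f(x;t)=\sum_i f_i(x_i;t)$ for $x\in\mathbb R^{nN}$. On vectors $y=(y_{ij})$ indexed by ordered pairs of adjacent nodes, let $(Ax)_{ij}=x_i$, $(Py)_{ij}=y_{ji}$, and let $h$ be the indicator function of $\ker(I-P)$. Let $t_k\ge0$ with $t_{k+1}-t_k=T_s>0$, $k\in\mathbb N$. Let $x^*(t_k)$ be the solution of $\min_{x,y} f(x;t_k)+h(y)$ subject to $Ax-y=0$, and, for $\epsilon\ge 0$, let $w^*(\epsilon;t_k)$ be a minimizer of $\frac{\epsilon}{2}\|w\|^2+f^\star(A^\top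 w;t_k)+h^\star(-w)$, where $^\star$ is the convex conjugate; $w^*(t_k)=w^*(0;t_k)$. **Algorithm.** Fix $\epsilon,\rho>0$, $\delta=1/(1+\epsilon\rho)$ and horizons $N_P,N_C\in\mathbb N$. One run of $M$ steps of the dual-regularized ADMM for local costs $\varphi_i$ from $z^0$ consists of $$x_i^\ell=\operatorname*{argmin}_{v\in\mathbb R^n}\Big\{\varphi_i(v)+\tfrac{\rho\delta d_i}{2}\|v\|^2-\delta\Big\langle v,\sum_{j\in\mathcal N_i}z_{ij}^\ell\Big\rangle\Big\},\qquad z_{ij}^{\ell+1}=(1-2\delta)z_{ji}^\ell+2\delta\rho x_j^\ell ,$$ with output $(x^M,z^M)$. From any $x_0,z_0$, for $k=0,1,\dots$: apply $N_P$ steps from $z_k$ to the quadratic costs $\hat f_{i,k+1}$ with $\nabla\hat f_{i,k+1}(v)=\nabla_x f_i(x_{i,k};t_k)+\nabla_{xx}f_i(x_{i,k};t_k)(v-x_{i,k})+T_s\nabla_{tx}f_i(x_{i,k};t_k)$, which gives $\hat z_{k+1}$; then apply $N_C$ steps from $\hat z_{k+1}$ to the costs $f_i(\cdot;t_{k+1})$,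 which gives $(x_{k+1},z_{k+1})$. **Constants.** $\bar\mu=\epsilon$, $\bar L=\epsilon+d_M/\mu$, $\bar\kappa=1+d_M/(\mu\epsilon)$, $\bar C_0=\sqrt{d_M}\,C_0/\mu$, $\omega=\frac{1+\rho\bar L}{1+\rho\bar\mu}$, $\lambda=\max\big\{\big|\frac{1-\rho\bar L}{1+\rho\bar L}\big|,\big|\frac{1-\rho\bar\mu}{1+\rho\bar\mu}\big|\big\}$; $\zeta(0)=1$, $\xi(0)=0$, and $\zeta(\ell)=\omega\lambda^\ell$, $\xi(\ell)=1+\omega\lambda^\ell$ for $\ell\ge1$; $$\eta_1(\epsilon)=\zeta(N_C)\big[\zeta(N_P)+2\bar\kappa\,\xi(N_P)\big],\qquad \eta_0(\epsilon)=\zeta(N_C)\frac{\bar C_0T_s}{\bar\mu}\big[\zeta(N_P)+2(1+\bar\kappa\,\xi(N_P))\big].$$ **Corollary 2 (Convergence to $x^*(t_k)$).** There are $\psi_0>0$ and $\epsilon_0>0$, depending only on the graph, the costs $f_i$ and their constants, such that the following holds for every $\epsilon\in(0,\epsilon_0)$, $\rho>0$ and every sampling $(t_k)$ as above. If $\max\{\|w^*(t_k)\|,\|w^*(\epsilon;t_k)\|\}\le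 C$ for all $k$ (for some choice of the solutions $w^*(t_k)$), and $N_P,N_C$ are such that $\eta_1(\epsilon)<1$, then every sequence $(x_k)$ generated by the algorithm satisfies $$\limsup_{k\to\infty}\|x_k-x^*(t_k)\|\le\frac{\|A\|}{\mu}\left[\frac{\eta_0(\epsilon)}{1-\eta_1(\epsilon)}+C(1+\psi_0\epsilon)\right]$$ (in particular the limsup is finite). -/

import Mathlib

open Set Filter Topology

namespace PCADMM

noncomputable section

/-- The decision space `ℝⁿ` of one node. -/
abbrev Vec (n : ℕ) : Type := EuclideanSpace ℝ (Fin n)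

/-- `ℝ^{nN}`: one copy of `ℝⁿ` for each node, with the Euclidean norm. -/
abbrev NodeSpace (V : Type*) (n : ℕ) : Type _ := PiLp 2 (fun _ : V => Vec n)

/-- `ℝ^{2n|E|}`: one copy of `ℝⁿ` for each ordered pair `(i, j)` of adjacent nodes, with the
Euclidean norm. A dart `e` of `G` is such a pair, `i = e.fst` and `j = e.snd`. -/
abbrev EdgeSpace {V : Type*} (G : SimpleGraph V) (n : ℕ) : Type _ :=
  PiLp 2 (fun _ : G.Dart => Vec n)

/-! ### Costs -/

/-- The class `S_{μ,L}`: `μ`-strongly convex and `L`-smooth functions. -/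
structure IsStronglyConvexSmooth {n : ℕ} (μ L : ℝ) (g : Vec n → ℝ) : Prop where
  strongConvex : StrongConvexOn univ μ g
  differentiable : Differentiable ℝ g
  lipschitz_gradient : ∀ x y, ‖gradient g x - gradient g y‖ ≤ L * ‖x - y‖

/-- The Hessian `∇_{xx} g (x)`, as a linear map. -/
def hessian {n : ℕ} (g : Vec n → ℝ) (x : Vec n) : Vec n →L[ℝ] Vec n :=
  fderiv ℝ (gradient g) x

/-- The mixed derivative `∇_{tx} g (x; t)` on the time domain `[0, ∞)` (one-sided at `t = 0`). -/
def mixedDeriv {n : ℕ} (g : ℝ → Vec n → ℝ) (t : ℝ) (x : Vec n) : Vec n :=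
  derivWithin (fun s => gradient (g s) x) (Ici 0) t

/-- The standing assumption on the local costs `f i t : ℝⁿ → ℝ`, `t ≥ 0`: they lie in `S_{μ,L}`
uniformly in time, and `∇_{tx} f_i` is bounded by `C₀`. The existence of the second derivatives
that the prediction step uses is part of it. -/
structure CostAssumption {V : Type*} {n : ℕ} (f : V → ℝ → Vec n → ℝ) (μ L C₀ : ℝ) : Prop where
  mem_class : ∀ i, ∀ t, 0 ≤ t → IsStronglyConvexSmooth μ L (f i t)
  hessian_exists : ∀ i, ∀ t, 0 ≤ t → Differentiable ℝ (gradient (f i t))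
  mixed_exists : ∀ i x, DifferentiableOn ℝ (fun s => gradient (f i s) x) (Ici 0)
  mixed_bound : ∀ i x t, 0 ≤ t → ‖mixedDeriv (f i) t x‖ ≤ C₀

/-- `f(x) = ∑ᵢ fᵢ(xᵢ)`. -/
def totalCost {V : Type*} [Fintype V] {n : ℕ} (φ : V → Vec n → ℝ) (x : NodeSpace V n) : ℝ :=
  ∑ i, φ i (x i)

/-- The predicted cost of a node: the quadratic function with gradient
`∇g(x₀;t) + ∇_{xx}g(x₀;t)(v - x₀) + Tₛ ∇_{tx}g(x₀;t)` at `v`. -/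
def predictedCost {n : ℕ} (g : ℝ → Vec n → ℝ) (t Ts : ℝ) (x₀ : Vec n) (v : Vec n) : ℝ :=
  g t x₀ + inner ℝ (gradient (g t) x₀) (v - x₀)
    + 1 / 2 * inner ℝ (v - x₀) (hessian (g t) x₀ (v - x₀))
    + Ts * inner ℝ (mixedDeriv g t x₀) (v - x₀)

/-! ### The consensus problem and its dual -/

section Problem

variable {V : Type*} [Fintype V] (G : SimpleGraph V) [DecidableRel G.Adj] (n : ℕ)

/-- The matrix `A`, `(A x)_{ij} = x_i`. -/
def A : NodeSpace V n →L[ℝ] EdgeSpace G n where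
  toFun x := WithLp.toLp 2 (fun e : G.Dart => x e.fst)
  map_add' _ _ := rfl
  map_smul' _ _ := rfl
  cont := by fun_prop

/-- The permutation matrix `P`, `(P y)_{ij} = y_{ji}`. -/
def P : EdgeSpace G n →L[ℝ] EdgeSpace G n where
  toFun y := WithLp.toLp 2 (fun e : G.Dart => y e.symm)
  map_add' _ _ := rfl
  map_smul' _ _ := rfl
  cont := by fun_prop

open Classical in
/-- The indicator function `h` of `ker (I - P)`. -/
def h (y : EdgeSpace G n) : EReal :=
  if y - P G n y = 0 then 0 else ⊤

/-- The convex conjugate. -/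
def conjugate {E : Type*} [NormedAddCommGroup E] [InnerProductSpace ℝ E]
    (g : E → EReal) (u : E) : EReal :=
  ⨆ x : E, ((inner ℝ u x : ℝ) : EReal) - g x

variable {n}

/-- `x` is the `x`-part of a solution of
`min f(x) + h(y)` subject to `A x - y = 0`, with `f(x) = ∑ᵢ φᵢ(xᵢ)`. -/
def IsPrimalSolution (φ : V → Vec n → ℝ) (x : NodeSpace V n) : Prop :=
  ∃ y : EdgeSpace G n, A G n x - y = 0 ∧
    IsMinOn (fun p : NodeSpace V n × EdgeSpace G n => (totalCost φ p.1 : EReal) + h G n p.2)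
      {p | A G n p.1 - p.2 = 0} (x, y)

/-- The regularized dual function `(ε/2)‖w‖² + f⋆(Aᵀw) + h⋆(-w)`; the original one for `ε = 0`. -/
def dualObjective (φ : V → Vec n → ℝ) (ε : ℝ) (w : EdgeSpace G n) : EReal :=
  ((ε / 2 * ‖w‖ ^ 2 : ℝ) : EReal)
    + conjugate (fun x => (totalCost φ x : EReal)) (ContinuousLinearMap.adjoint (A G n) w)
    + conjugate (h G n) (-w)

/-- `w` solves the (regularized, if `ε > 0`) dual problem. -/
def IsDualSolution (φ : V → Vec n → ℝ) (ε : ℝ) (w : EdgeSpace G n) : Prop :=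
  IsMinOn (dualObjective G φ ε) univ w

/-! ### The algorithm -/

/-- `δ = 1 / (1 + ερ)`. -/
def delta (ε ρ : ℝ) : ℝ := 1 / (1 + ε * ρ)

variable [DecidableEq V]

/-- Local update: every node `i` minimizes
`φᵢ(v) + (ρδdᵢ/2)‖v‖² - δ⟨v, ∑_{j ∈ Nᵢ} z_{ij}⟩`. -/
def IsLocalUpdate (φ : V → Vec n → ℝ) (ε ρ : ℝ) (z : EdgeSpace G n) (x : NodeSpace V n) : Prop :=
  ∀ i, IsMinOn (fun v : Vec n => φ i v + ρ * delta ε ρ * (G.degree i : ℝ) / 2 * ‖v‖ ^ 2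
      - delta ε ρ * inner ℝ v (∑ e : G.Dart with e.fst = i, z e)) univ (x i)

/-- Auxiliary update: `z_{ij}⁺ = (1 - 2δ) z_{ji} + 2δρ x_j`, that is,
`z⁺ = (1 - 2δ) P z + 2δρ P A x`. -/
def auxUpdate (ε ρ : ℝ) (z : EdgeSpace G n) (x : NodeSpace V n) : EdgeSpace G n :=
  WithLp.toLp 2 (fun e : G.Dart =>
    (1 - 2 * delta ε ρ) • z e.symm + (2 * delta ε ρ * ρ) • x e.snd)

/-- `xOut = x^M` and `zOut = z^M`, where `(x^ℓ, z^ℓ)` are the iterates of the distributed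
dual-regularized ADMM for the local costs `φ`, started at `z⁰ = z₀`. -/
def IsADMMOutput (φ : V → Vec n → ℝ) (ε ρ : ℝ) (M : ℕ) (z₀ : EdgeSpace G n)
    (xOut : NodeSpace V n) (zOut : EdgeSpace G n) : Prop :=
  ∃ (x : ℕ → NodeSpace V n) (z : ℕ → EdgeSpace G n),
    z 0 = z₀ ∧
    (∀ ℓ, IsLocalUpdate G φ ε ρ (z ℓ) (x ℓ)) ∧
    (∀ ℓ, z (ℓ + 1) = auxUpdate G ε ρ (z ℓ) (x ℓ)) ∧
    xOut = x M ∧ zOut = z M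

/-- `(x_k, z_k)` is generated by the prediction-correction dual-regularized ADMM with horizons
`NP`, `NC`, from arbitrary initial `x_0`, `z_0`: at each `k`, `NP` steps on the predicted costs
started at `z_k`, then `NC` steps on the costs at time `t_{k+1}` started at the result. -/
def IsPredictionCorrectionRun (f : V → ℝ → Vec n → ℝ) (t : ℕ → ℝ) (Ts ε ρ : ℝ) (NP NC : ℕ)
    (x : ℕ → NodeSpace V n) (z : ℕ → EdgeSpace G n) : Prop :=
  ∀ k, ∃ (xhat : NodeSpace V n) (zhat : EdgeSpace G n),
    IsADMMOutput G (fun i => predictedCost (f i) (t k) Ts (x k i)) ε ρ NP (z k) xhat zhat ∧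
    IsADMMOutput G (fun i => f i (t (k + 1))) ε ρ NC zhat (x (k + 1)) (z (k + 1))

end Problem

/-! ### Constants (`dM` is the maximum degree of the network) -/

/-- `μ̄(ε) = ε`. -/
def muBar (ε : ℝ) : ℝ := ε

/-- `L̄(ε) = ε + dM / μ`. -/
def LBar (dM : ℕ) (μ ε : ℝ) : ℝ := ε + dM / μ

/-- `κ̄(ε) = 1 + dM / (με)`. -/
def kappaBar (dM : ℕ) (μ ε : ℝ) : ℝ := 1 + dM / (μ * ε)

/-- `C̄₀ = √dM C₀ / μ`. -/
def C0Bar (dM : ℕ) (μ C₀ : ℝ) : ℝ := Real.sqrt dM * C₀ / μ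

/-- The Lipschitz constant `λ(ε)` of the Peaceman-Rachford operator. -/
def lam (dM : ℕ) (μ ρ ε : ℝ) : ℝ :=
  max |(1 - ρ * LBar dM μ ε) / (1 + ρ * LBar dM μ ε)| |(1 - ρ * muBar ε) / (1 + ρ * muBar ε)|

/-- `ω(ε)`. -/
def omega (dM : ℕ) (μ ρ ε : ℝ) : ℝ := (1 + ρ * LBar dM μ ε) / (1 + ρ * muBar ε)

/-- `ζ(ℓ; ε)`. -/
def zeta (dM : ℕ) (μ ρ : ℝ) (ℓ : ℕ) (ε : ℝ) : ℝ :=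
  if ℓ = 0 then 1 else omega dM μ ρ ε * lam dM μ ρ ε ^ ℓ

/-- `ξ(ℓ; ε)`. -/
def xi (dM : ℕ) (μ ρ : ℝ) (ℓ : ℕ) (ε : ℝ) : ℝ :=
  if ℓ = 0 then 0 else 1 + omega dM μ ρ ε * lam dM μ ρ ε ^ ℓ

/-- `η₁(ε)`. -/
def eta1 (dM : ℕ) (μ ρ : ℝ) (NP NC : ℕ) (ε : ℝ) : ℝ :=
  zeta dM μ ρ NC ε * (zeta dM μ ρ NP ε + 2 * kappaBar dM μ ε * xi dM μ ρ NP ε)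

/-- `η₀(ε)`. -/
def eta0 (dM : ℕ) (μ C₀ Ts ρ : ℝ) (NP NC : ℕ) (ε : ℝ) : ℝ :=
  zeta dM μ ρ NC ε * (C0Bar dM μ C₀ * Ts / muBar ε)
    * (zeta dM μ ρ NP ε + 2 * (1 + kappaBar dM μ ε * xi dM μ ρ NP ε))

end

end PCADMM

/-! The algorithm is Peaceman-Rachford splitting on the regularized dual. With `w = δ(z - ρAx)`, the
local update says that `∇f(x) = Aᵀw` and `z = (1 + ερ)w + ρAx`. So `w` is the resolvent at `z` of
`ρ` times the gradient `εw + Ax` of the smooth part of the dual, and the auxiliary update is `z⁺ =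
-P(2w - z)`. Since `h⋆(-w)` is the indicator of the skew vectors `Pw = -w`, the map `-P` is the
reflection belonging to it. The dual gradient is `ε`-strongly monotone, and `w ↦ Ax` is cocoercive
with constant `d_M/μ`. The reflected resolvent therefore contracts by `λ` (`norm_reflected_le`),
towards the fixed point `w + ρ(εw + Ax)` given by a saddle point. Distances in `z` and in `w` are
comparable with constants `1 + ρL̄` and `1 + ρμ̄`, whose quotient is `ω`.

The delicate point is the constant `C̄₀`. The bound `C₀` holds node by node, so in one sampling
period `Ax(w)` moves by up to `√N √d_M C₀Tₛ/μ`, which is `√N` times what `η₀` allows. Smallness of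
`ε` compensates for this. Regularized dual solutions are skew and orthogonal to the skew kernel of
`Aᵀ`, and on such vectors `Aᵀ` is bounded below (`exists_mul_norm_sq_le_adjoint`). Between them the
dual gradient is thus strongly monotone with modulus `ε + m`, where `m > 0` does not depend on `ε`
(`IsSaddle.mul_norm_sub_le`). For `2√N ε ≤ m` the drift of the dual solution is at most half of
`C̄₀Tₛ/ε`.

Comparing the predicted saddle point with the next true one and adding the contraction of both
phases gives the affine recursion with `η₁` and `η₀` (`prediction_error_le`, `tracking_error_le`).
The regularization error satisfies `‖w*(ε) - w*‖ ≤ ‖w*‖ ≤ C` (`norm_sub_le_of_isSaddle`), so every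
`ψ₀ > 0` would do. Strong convexity converts dual distances into primal ones with factor `‖A‖/μ`. -/

namespace PCADMM

/-! ### Strongly monotone Lipschitz operators and the reflected resolvent. -/

section StronglyMonotone

variable {X Y : Type*} [NormedAddCommGroup X] [InnerProductSpace ℝ X]
  [NormedAddCommGroup Y] [InnerProductSpace ℝ Y]

/-- `μ`-strongly monotone and `L`-Lipschitz operators. -/
structure StronglyMonotoneLipschitz (μ L : ℝ) (F : X → X) : Prop where
  mono : ∀ x y, μ * ‖x - y‖ ^ 2 ≤ inner ℝ (F x - F y) (x - y)
  lip : ∀ x y, ‖F x - F y‖ ≤ L * ‖x - y‖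

namespace StronglyMonotoneLipschitz

variable {μ L : ℝ} {F : X → X}

theorem mul_norm_sub_le (hF : StronglyMonotoneLipschitz μ L F) (x y : X) :
    μ * ‖x - y‖ ≤ ‖F x - F y‖ := by
  rcases eq_or_lt_of_le (norm_nonneg (x - y)) with h0 | h0
  · rw [← h0]; simp
  · have h1 := hF.mono x y
    have h2 := real_inner_le_norm (F x - F y) (x - y)
    nlinarith

/-- A forward step `x - τ(F x - u)` is a contraction for suitable `τ`, and its fixed point solves `F
x = u`. -/
theorem surjective [CompleteSpace X] (hF : StronglyMonotoneLipschitz μ L F) (hμ : 0 < μ)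
    (hL : 0 < L) : Function.Surjective F := by
  intro u
  -- This is the minimum over `τ` of `1 - 2τμ + τ²L²`, attained at the step `τ = μ/L²`.
  set q : ℝ := 1 - (μ / L) ^ 2 with hq
  have hq1 : q < 1 := by
    have : 0 < (μ / L) ^ 2 := by positivity
    linarith
  set T : X → X := fun x => x - (μ / L ^ 2) • (F x - u) with hT
  have key : ∀ x y, ‖T x - T y‖ ^ 2 ≤ q * ‖x - y‖ ^ 2 := by
    intro x y
    have e : T x - T y = (x - y) - (μ / L ^ 2) • (F x - F y) := by
      simp only [hT]; module
    rw [e, norm_sub_sq_real, inner_smul_right, real_inner_comm, norm_smul, mul_pow,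
      Real.norm_eq_abs, sq_abs]
    have h1 := hF.mono x y
    have h2 : ‖F x - F y‖ ^ 2 ≤ L ^ 2 * ‖x - y‖ ^ 2 := by
      rw [← mul_pow]; exact pow_le_pow_left₀ (norm_nonneg _) (hF.lip x y) 2
    have h3 : (μ / L ^ 2) * (μ * ‖x - y‖ ^ 2) ≤ (μ / L ^ 2) * inner ℝ (F x - F y) (x - y) :=
      mul_le_mul_of_nonneg_left h1 (by positivity)
    have h4 : (μ / L ^ 2) ^ 2 * ‖F x - F y‖ ^ 2 ≤ (μ / L ^ 2) ^ 2 * (L ^ 2 * ‖x - y‖ ^ 2) :=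
      mul_le_mul_of_nonneg_left h2 (by positivity)
    have e1 : (μ / L ^ 2) * (μ * ‖x - y‖ ^ 2) = (μ / L) ^ 2 * ‖x - y‖ ^ 2 := by
      field_simp
    have e2 : (μ / L ^ 2) ^ 2 * (L ^ 2 * ‖x - y‖ ^ 2) = (μ / L) ^ 2 * ‖x - y‖ ^ 2 := by
      field_simp
    rw [hq]; nlinarith
  have hc : ContractingWith (Real.toNNReal (Real.sqrt q)) T := by
    refine ⟨?_, LipschitzWith.of_dist_le_mul fun x y => ?_⟩
    · rw [← NNReal.coe_lt_coe, Real.coe_toNNReal _ (Real.sqrt_nonneg _), NNReal.coe_one,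
        Real.sqrt_lt' one_pos]
      simpa using hq1
    · rw [Real.coe_toNNReal _ (Real.sqrt_nonneg _), dist_eq_norm, dist_eq_norm]
      calc ‖T x - T y‖ = Real.sqrt (‖T x - T y‖ ^ 2) := (Real.sqrt_sq (norm_nonneg _)).symm
        _ ≤ Real.sqrt (q * ‖x - y‖ ^ 2) := Real.sqrt_le_sqrt (key x y)
        _ = Real.sqrt q * ‖x - y‖ := by
          rw [Real.sqrt_mul' _ (sq_nonneg _), Real.sqrt_sq (norm_nonneg _)]
  have hfix := hc.fixedPoint_isFixedPt
  refine ⟨hc.fixedPoint, ?_⟩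
  have h1 : (μ / L ^ 2) • (F hc.fixedPoint - u) = 0 := by
    have h2 : hc.fixedPoint - (μ / L ^ 2) • (F hc.fixedPoint - u) = hc.fixedPoint := hfix
    simpa using h2
  rcases smul_eq_zero.1 h1 with h | h
  · exact absurd h (by positivity)
  · exact sub_eq_zero.1 h

variable [CompleteSpace X] [CompleteSpace Y] {A : X →L[ℝ] Y} {x x' : X} {w w' : Y}

theorem mul_norm_sq_le_inner (hF : StronglyMonotoneLipschitz μ L F)
    (hx : F x = ContinuousLinearMap.adjoint A w) (hx' : F x' = ContinuousLinearMap.adjoint A w') :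
    μ * ‖x - x'‖ ^ 2 ≤ inner ℝ (w - w') (A x - A x') := by
  have h := hF.mono x x'
  rwa [hx, hx', ← map_sub, ContinuousLinearMap.adjoint_inner_left, map_sub] at h

/-- Recovering the primal point from the dual one is Lipschitz. -/
theorem norm_sub_le_of_adjoint (hF : StronglyMonotoneLipschitz μ L F) (hμ : 0 < μ)
    (hx : F x = ContinuousLinearMap.adjoint A w) (hx' : F x' = ContinuousLinearMap.adjoint A w') :
    ‖x - x'‖ ≤ ‖A‖ / μ * ‖w - w'‖ := by
  have h := hF.mul_norm_sub_le x x'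
  rw [hx, hx', ← map_sub] at h
  have h2 := (ContinuousLinearMap.adjoint A).le_opNorm (w - w')
  rw [LinearIsometryEquiv.norm_map] at h2
  rw [div_mul_eq_mul_div, le_div_iff₀ hμ]
  linarith

/-- `w ↦ A x(w)` is cocoercive. -/
theorem norm_sq_le_inner {d : ℝ} (hF : StronglyMonotoneLipschitz μ L F) (hμ : 0 < μ)
    (hd : 0 ≤ d) (hA : ∀ x, ‖A x‖ ^ 2 ≤ d * ‖x‖ ^ 2)
    (hx : F x = ContinuousLinearMap.adjoint A w) (hx' : F x' = ContinuousLinearMap.adjoint A w') :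
    ‖A x - A x'‖ ^ 2 ≤ d / μ * inner ℝ (w - w') (A x - A x') := by
  have h := hF.mul_norm_sq_le_inner hx hx'
  have h2 := hA (x - x')
  rw [map_sub] at h2
  rw [div_mul_eq_mul_div, le_div_iff₀ hμ]
  nlinarith

theorem norm_map_sub_le {d : ℝ} (hF : StronglyMonotoneLipschitz μ L F) (hμ : 0 < μ)
    (hd : 0 ≤ d) (hA : ∀ x, ‖A x‖ ^ 2 ≤ d * ‖x‖ ^ 2)
    (hx : F x = ContinuousLinearMap.adjoint A w) (hx' : F x' = ContinuousLinearMap.adjoint A w') :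
    ‖A x - A x'‖ ≤ d / μ * ‖w - w'‖ := by
  have h := hF.norm_sq_le_inner hμ hd hA hx hx'
  have h2 := real_inner_le_norm (w - w') (A x - A x')
  have hb : 0 ≤ d / μ := by positivity
  rcases eq_or_lt_of_le (norm_nonneg (A x - A x')) with h0 | h0
  · rw [← h0]; positivity
  · have h3 := mul_le_mul_of_nonneg_left h2 hb
    nlinarith

end StronglyMonotoneLipschitz

/-- The reflected resolvent estimate behind the Peaceman-Rachford contraction. -/
theorem norm_reflected_le {e b : ℝ} (he : 0 < e) (hb : 0 ≤ b) (a s : Y)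
    (hs : ‖s‖ ^ 2 ≤ b * inner ℝ a s) :
    ‖(1 - e) • a - s‖ ≤
      max |(1 - (e + b)) / (1 + (e + b))| |(1 - e) / (1 + e)| * ‖(1 + e) • a + s‖ := by
  set m : ℝ := (1 - e) / (1 + e) with hm
  set l : ℝ := (1 - (e + b)) / (1 + (e + b)) with hl
  set z : Y := (1 + e) • a + s with hz
  set r : Y := (1 - e) • a - s with hr
  have he1 : (0 : ℝ) < 1 + e := by linarith
  have hb1 : (0 : ℝ) < 1 + (e + b) := by linarith
  have e1 : r - m • z = (-(1 + m)) • s := by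
    have : m * (1 + e) = 1 - e := by rw [hm]; field_simp
    rw [hr, hz, smul_add, smul_smul, this]; module
  have e2 : r - l • z = (1 + l) • (b • a - s) := by
    have h1 : l * (1 + (e + b)) = 1 - (e + b) := by rw [hl]; field_simp
    have h2 : 1 - e - l * (1 + e) = (1 + l) * b := by linarith
    have : (1 - e) = l * (1 + e) + (1 + l) * b := by linarith
    rw [hr, hz, this]; module
  have hm1 : 0 ≤ 1 + m := by
    have : 1 + m = 2 / (1 + e) := by rw [hm]; field_simp; ring
    rw [this]; positivity
  have hl1 : 0 ≤ 1 + l := by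
    have : 1 + l = 2 / (1 + (e + b)) := by rw [hl]; field_simp; ring
    rw [this]; positivity
  have hml : l ≤ m := by
    rw [hl, hm, div_le_div_iff₀ hb1 he1]; nlinarith
  -- By the Thales criterion, `r` lies in the ball with diameter from `l • z` to `m • z`. This is
  -- where cocoercivity of `s` enters; the rest is the norm of the farthest point of that ball.
  have hin : inner ℝ (r - m • z) (r - l • z) ≤ 0 := by
    rw [e1, e2, inner_smul_left, inner_smul_right, inner_sub_right, inner_smul_right,
      real_inner_comm, real_inner_self_eq_norm_sq]
    simp only [conj_trivial]
    have : 0 ≤ (1 + m) * (1 + l) * (b * inner ℝ a s - ‖s‖ ^ 2) :=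
      mul_nonneg (mul_nonneg hm1 hl1) (by linarith)
    linarith
  have hball : ‖r - ((m + l) / 2) • z‖ ≤ (m - l) / 2 * ‖z‖ := by
    refine abs_le_of_sq_le_sq' ?_ (mul_nonneg (by linarith) (norm_nonneg _)) |>.2
    have h1 : inner ℝ (r - m • z) (r - l • z)
        = ‖r‖ ^ 2 - (m + l) * inner ℝ r z + m * l * ‖z‖ ^ 2 := by
      simp only [inner_sub_left, inner_sub_right, inner_smul_left, inner_smul_right,
        real_inner_self_eq_norm_sq, conj_trivial, real_inner_comm r z]
      ring
    rw [norm_sub_sq_real, inner_smul_right, norm_smul, mul_pow, Real.norm_eq_abs, sq_abs]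
    nlinarith
  have hfin : ‖r‖ ≤ (m - l) / 2 * ‖z‖ + |(m + l) / 2| * ‖z‖ := by
    calc ‖r‖ = ‖(r - ((m + l) / 2) • z) + ((m + l) / 2) • z‖ := by simp
      _ ≤ _ := (norm_add_le _ _).trans (add_le_add hball (by rw [norm_smul, Real.norm_eq_abs]))
  refine hfin.trans ?_
  rw [← add_mul]
  refine mul_le_mul_of_nonneg_right ?_ (norm_nonneg _)
  rcases abs_cases ((m + l) / 2) with h | h
  · rw [h.1]; exact le_max_of_le_right (by linarith [le_abs_self m])
  · rw [h.1]; exact le_max_of_le_left (by linarith [neg_abs_le l])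

end StronglyMonotone

/-! ### Symmetric involutions: symmetric and skew vectors are orthogonal. -/

section SymmetricInvolution

variable {Y : Type*} [NormedAddCommGroup Y] [InnerProductSpace ℝ Y]

/-- Symmetric involutions. -/
structure IsSymmetricInvolution (P : Y →L[ℝ] Y) : Prop where
  invol : ∀ y, P (P y) = y
  symm : ∀ y y', inner ℝ (P y) y' = inner ℝ y (P y')

namespace IsSymmetricInvolution

variable {P : Y →L[ℝ] Y}

theorem norm_map (hP : IsSymmetricInvolution P) (y : Y) : ‖P y‖ = ‖y‖ := by
  have h := hP.symm y (P y)
  rw [hP.invol, real_inner_self_eq_norm_sq, real_inner_self_eq_norm_sq] at h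
  exact (sq_eq_sq₀ (norm_nonneg _) (norm_nonneg _)).1 h

theorem inner_eq_zero (hP : IsSymmetricInvolution P) {w g : Y} (hw : P w = -w) (hg : P g = g) :
    inner ℝ g w = 0 := by
  have h := hP.symm g w
  rw [hw, hg, inner_neg_right] at h
  linarith

end IsSymmetricInvolution

end SymmetricInvolution

/-! ### Resolvents, saddle points and Peaceman-Rachford iterations. -/

section Splitting

variable {X Y : Type*} [NormedAddCommGroup X] [InnerProductSpace ℝ X] [CompleteSpace X]
  [NormedAddCommGroup Y] [InnerProductSpace ℝ Y] [CompleteSpace Y]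

/-- `w` is the resolvent at `z` of `ρ` times the gradient of the regularized dual function, and
`x` is the associated primal point; `F` is the gradient of the primal cost. -/
structure IsResolvent (F : X → X) (A : X →L[ℝ] Y) (ε ρ : ℝ) (z : Y) (x : X) (w : Y) : Prop where
  stationary : F x = ContinuousLinearMap.adjoint A w
  eq : z = (1 + ε * ρ) • w + ρ • A x

/-- Optimality conditions of the regularized dual problem. -/
structure IsSaddle (F : X → X) (A : X →L[ℝ] Y) (P : Y →L[ℝ] Y) (ε : ℝ) (x : X) (w : Y) :
    Prop where
  stationary : F x = ContinuousLinearMap.adjoint A w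
  skew : P w = -w
  symm : P (ε • w + A x) = ε • w + A x

variable {F F' : X → X} {A : X →L[ℝ] Y} {P : Y →L[ℝ] Y} {μ L ε ρ : ℝ} {dM : ℕ}
  {x x' x'' : X} {w w' z z' : Y}

theorem IsSaddle.isResolvent (h : IsSaddle F A P ε x w) (ρ : ℝ) :
    IsResolvent F A ε ρ (w + ρ • (ε • w + A x)) x w :=
  ⟨h.stationary, by module⟩

theorem IsSaddle.fixed (h : IsSaddle F A P ε x w) (ρ : ℝ) :
    -P ((2 : ℝ) • w - (w + ρ • (ε • w + A x))) = w + ρ • (ε • w + A x) := by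
  have e : (2 : ℝ) • w - (w + ρ • (ε • w + A x)) = w - ρ • (ε • w + A x) := by module
  rw [e, map_sub, map_smul, h.symm, h.skew]
  module

namespace IsResolvent

/-- This is `norm_reflected_le` for `a = w - w'` and `s = ρ(Ax - Ax')`, with `e = ρμ̄` and `e + b =
ρL̄`. -/
theorem norm_reflected_sub_le (hF : StronglyMonotoneLipschitz μ L F) (hμ : 0 < μ)
    (hε : 0 < ε) (hρ : 0 < ρ) (hA : ∀ x, ‖A x‖ ^ 2 ≤ dM * ‖x‖ ^ 2)
    (h : IsResolvent F A ε ρ z x w) (h' : IsResolvent F A ε ρ z' x' w') :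
    ‖((2 : ℝ) • w - z) - ((2 : ℝ) • w' - z')‖ ≤ lam dM μ ρ ε * ‖z - z'‖ := by
  have hco := hF.norm_sq_le_inner hμ (Nat.cast_nonneg dM) hA h.stationary h'.stationary
  have hs : ‖ρ • (A x - A x')‖ ^ 2 ≤
      (ρ * (dM / μ)) * inner ℝ (w - w') (ρ • (A x - A x')) := by
    rw [norm_smul, mul_pow, Real.norm_eq_abs, sq_abs, inner_smul_right]
    have := mul_le_mul_of_nonneg_left hco (sq_nonneg ρ)
    linarith
  have key := norm_reflected_le (e := ε * ρ) (mul_pos hε hρ)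
    (b := ρ * (dM / μ)) (by positivity) (w - w') (ρ • (A x - A x')) hs
  have e1 : ((2 : ℝ) • w - z) - ((2 : ℝ) • w' - z')
      = (1 - ε * ρ) • (w - w') - ρ • (A x - A x') := by
    rw [h.eq, h'.eq]; module
  have e2 : z - z' = (1 + ε * ρ) • (w - w') + ρ • (A x - A x') := by
    rw [h.eq, h'.eq]; module
  have e3 : ε * ρ + ρ * (dM / μ) = ρ * LBar dM μ ε := by unfold LBar; ring
  have e4 : ε * ρ = ρ * muBar ε := by unfold muBar; ring
  rw [e1, e2]
  rw [e3] at key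
  unfold lam
  rw [← e4]
  exact key

/-- Together with `norm_sub_le` below, this makes distances in `z` and in `w` equivalent; the
quotient of the two constants is `ω`. -/
theorem mul_norm_sub_le (hF : StronglyMonotoneLipschitz μ L F) (hμ : 0 < μ)
    (hρ : 0 < ρ)
    (h : IsResolvent F A ε ρ z x w) (h' : IsResolvent F A ε ρ z' x' w') :
    (1 + ρ * ε) * ‖w - w'‖ ≤ ‖z - z'‖ := by
  have hm := hF.mul_norm_sq_le_inner h.stationary h'.stationary
  have e2 : z - z' = (1 + ρ * ε) • (w - w') + ρ • (A x - A x') := by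
    rw [h.eq, h'.eq]; module
  have h1 : (1 + ρ * ε) * ‖w - w'‖ ^ 2 ≤ inner ℝ (w - w') (z - z') := by
    rw [e2, inner_add_right, inner_smul_right, inner_smul_right, real_inner_self_eq_norm_sq]
    have : 0 ≤ ρ * inner ℝ (w - w') (A x - A x') :=
      mul_nonneg hρ.le (le_trans (by positivity) hm)
    linarith
  have h2 := real_inner_le_norm (w - w') (z - z')
  rcases eq_or_lt_of_le (norm_nonneg (w - w')) with h0 | h0
  · rw [← h0]; simp
  · nlinarith

theorem norm_sub_le (hF : StronglyMonotoneLipschitz μ L F) (hμ : 0 < μ)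
    (hε : 0 < ε) (hρ : 0 < ρ) (hA : ∀ x, ‖A x‖ ^ 2 ≤ dM * ‖x‖ ^ 2)
    (h : IsResolvent F A ε ρ z x w) (h' : IsResolvent F A ε ρ z' x' w') :
    ‖z - z'‖ ≤ (1 + ρ * LBar dM μ ε) * ‖w - w'‖ := by
  have hm := hF.norm_map_sub_le hμ (Nat.cast_nonneg dM) hA h.stationary h'.stationary
  have e2 : z - z' = (1 + ρ * ε) • (w - w') + ρ • (A x - A x') := by
    rw [h.eq, h'.eq]; module
  have h3 : 0 < 1 + ρ * ε := by positivity
  calc ‖z - z'‖ ≤ (1 + ρ * ε) * ‖w - w'‖ + ρ * ‖A x - A x'‖ := by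
        rw [e2]
        refine (norm_add_le _ _).trans_eq ?_
        rw [norm_smul, norm_smul, Real.norm_of_nonneg h3.le, Real.norm_of_nonneg hρ.le]
    _ ≤ (1 + ρ * ε) * ‖w - w'‖ + ρ * (dM / μ * ‖w - w'‖) := by gcongr
    _ = _ := by unfold LBar; ring

end IsResolvent

theorem lam_nonneg : 0 ≤ lam dM μ ρ ε := le_max_of_le_left (abs_nonneg _)

theorem abs_cayley_le_one {a : ℝ} (ha : 0 ≤ a) : |(1 - a) / (1 + a)| ≤ 1 := by
  rw [abs_le]
  constructor
  · rw [le_div_iff₀ (by linarith)]; linarith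
  · rw [div_le_one (by linarith)]; linarith

theorem lam_le_one (hμ : 0 < μ) (hε : 0 < ε) (hρ : 0 < ρ) : lam dM μ ρ ε ≤ 1 := by
  refine max_le (abs_cayley_le_one ?_) (abs_cayley_le_one ?_)
  · unfold LBar; positivity
  · unfold muBar; positivity

/-- Linear convergence of the Peaceman-Rachford iterates to a fixed point. -/
theorem norm_iterate_sub_le (hP : IsSymmetricInvolution P)
    (hF : StronglyMonotoneLipschitz μ L F) (hμ : 0 < μ)
    (hε : 0 < ε) (hρ : 0 < ρ) (hA : ∀ x, ‖A x‖ ^ 2 ≤ dM * ‖x‖ ^ 2)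
    {zs : ℕ → Y} {xs : ℕ → X} {ws : ℕ → Y} (hr : ∀ ℓ, IsResolvent F A ε ρ (zs ℓ) (xs ℓ) (ws ℓ))
    (hz : ∀ ℓ, zs (ℓ + 1) = -P ((2 : ℝ) • ws ℓ - zs ℓ))
    (hfix : IsResolvent F A ε ρ z x w) (hz' : -P ((2 : ℝ) • w - z) = z) (M : ℕ) :
    ‖zs M - z‖ ≤ lam dM μ ρ ε ^ M * ‖zs 0 - z‖ := by
  induction M with
  | zero => simp
  | succ M ih =>
    have e : zs (M + 1) - z = -P (((2 : ℝ) • ws M - zs M) - ((2 : ℝ) • w - z)) := by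
      rw [map_sub]
      conv_lhs => rw [hz, ← hz']
      abel
    rw [e, norm_neg, hP.norm_map]
    calc _ ≤ lam dM μ ρ ε * ‖zs M - z‖ :=
          (hr M).norm_reflected_sub_le hF hμ hε hρ hA hfix
      _ ≤ lam dM μ ρ ε * (lam dM μ ρ ε ^ M * ‖zs 0 - z‖) :=
          mul_le_mul_of_nonneg_left ih lam_nonneg
      _ = _ := by ring

/-- The dual variables of a regularized saddle point are orthogonal to the circulations. -/
theorem IsSaddle.inner_eq_zero (hP : IsSymmetricInvolution P) (hε : 0 < ε)
    (h : IsSaddle F A P ε x w) {v : Y} (hv : P v = -v)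
    (hv' : ContinuousLinearMap.adjoint A v = 0) : inner ℝ w v = 0 := by
  have h1 := hP.inner_eq_zero hv h.symm
  rw [inner_add_left, inner_smul_left, ← ContinuousLinearMap.adjoint_inner_right, hv',
    inner_zero_right, add_zero] at h1
  simpa [hε.ne'] using h1

/-- Two saddle points of different problems are as close as the primal points that the two
problems assign to one and the same dual point. The dual function is more convex than its
regularization along the directions that matter. -/
theorem IsSaddle.mul_norm_sub_le {s r : ℝ} (hP : IsSymmetricInvolution P)
    (hF : StronglyMonotoneLipschitz μ L F) (hμ : 0 < μ) (hL : 0 < L) (hε : 0 < ε)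
    (hs : ∀ w, P w = -w →
      (∀ v, P v = -v → ContinuousLinearMap.adjoint A v = 0 → inner ℝ w v = 0) →
      s * ‖w‖ ^ 2 ≤ ‖ContinuousLinearMap.adjoint A w‖ ^ 2)
    (h : IsSaddle F A P ε x w) (h' : IsSaddle F' A P ε x' w')
    (hx : F x'' = ContinuousLinearMap.adjoint A w') (hr : ‖A x'' - A x'‖ ≤ r) :
    (ε + μ * s / L ^ 2) * ‖w - w'‖ ≤ r := by
  have hskew : P (w - w') = -(w - w') := by rw [map_sub, h.skew, h'.skew]; abel
  have h1 := hs (w - w') hskew fun v hv hv' => by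
    rw [inner_sub_left, h.inner_eq_zero hP hε hv hv', h'.inner_eq_zero hP hε hv hv', sub_zero]
  have h2 := hF.mul_norm_sq_le_inner h.stationary hx
  have h3 : ‖ContinuousLinearMap.adjoint A (w - w')‖ ^ 2 ≤ L ^ 2 * ‖x - x''‖ ^ 2 := by
    rw [map_sub, ← h.stationary, ← hx, ← mul_pow]
    exact pow_le_pow_left₀ (norm_nonneg _) (hF.lip _ _) 2
  have h4 : μ * s / L ^ 2 * ‖w - w'‖ ^ 2 ≤ inner ℝ (w - w') (A x - A x'') := by
    refine le_trans ?_ h2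
    rw [div_mul_eq_mul_div, div_le_iff₀ (by positivity)]
    have := mul_le_mul_of_nonneg_left (h1.trans h3) hμ.le
    linarith
  -- The difference of the two dual gradients is fixed by `P` while `w - w'` is skew, so they are
  -- orthogonal. Inserting `A x''` separates a monotone part, where only `F` occurs, from the
  -- perturbation.
  have h5 : inner ℝ (w - w') (ε • (w - w') + (A x - A x'')) + inner ℝ (w - w') (A x'' - A x')
      = 0 := by
    have e : (ε • (w - w') + (A x - A x'')) = (ε • w + A x) - (ε • w' + A x')
        - (A x'' - A x') := by module
    rw [e, inner_sub_right, sub_add_cancel, inner_sub_right, real_inner_comm,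
      hP.inner_eq_zero hskew h.symm, real_inner_comm, hP.inner_eq_zero hskew h'.symm, sub_zero]
  rw [inner_add_right, inner_smul_right, real_inner_self_eq_norm_sq] at h5
  have h6 := (abs_le.1 (abs_real_inner_le_norm (w - w') (A x'' - A x'))).1
  have h7 : ‖w - w'‖ * ‖A x'' - A x'‖ ≤ ‖w - w'‖ * r :=
    mul_le_mul_of_nonneg_left hr (norm_nonneg _)
  rcases eq_or_lt_of_le (norm_nonneg (w - w')) with h0 | h0
  · rw [← h0, mul_zero]; exact (norm_nonneg _).trans hr
  · have h8 : (ε + μ * s / L ^ 2) * ‖w - w'‖ ^ 2 ≤ ‖w - w'‖ * r := by linarith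
    refine le_of_mul_le_mul_right ?_ h0
    linarith

/-- The dual gradient, compressed to the skew vectors by the orthogonal projection `Q = (1 - P)/2`,
is strongly monotone and Lipschitz once `εw` is added on the whole space. Its zero is automatically
skew, hence a saddle point. -/
theorem exists_isSaddle (hP : IsSymmetricInvolution P) (hF : StronglyMonotoneLipschitz μ L F)
    (hμ : 0 < μ) (hL : 0 < L) (hε : 0 < ε) : ∃ x w, IsSaddle F A P ε x w := by
  obtain ⟨g, hg⟩ := (hF.surjective hμ hL).hasRightInverse
  set Q : Y → Y := fun y => (1 / 2 : ℝ) • (y - P y) with hQ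
  have hQsub : ∀ y y', Q y - Q y' = Q (y - y') := fun y y' => by
    simp only [hQ, map_sub]; module
  have hQsymm : ∀ y y', inner ℝ (Q y) y' = inner ℝ y (Q y') := fun y y' => by
    simp only [hQ, inner_smul_left, inner_smul_right, inner_sub_left, inner_sub_right,
      hP.symm, conj_trivial]
  have hPQ : ∀ y, P (Q y) = -Q y := fun y => by
    simp only [hQ, map_smul, map_sub, hP.invol]; module
  have hQnorm : ∀ y, ‖Q y‖ ≤ ‖y‖ := fun y => by
    have h := norm_sub_le y (P y)
    rw [hP.norm_map] at h
    simp only [hQ, norm_smul]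
    norm_num
    linarith
  set T : Y → X := fun w => g (ContinuousLinearMap.adjoint A (Q w)) with hT
  have hFT : ∀ w, F (T w) = ContinuousLinearMap.adjoint A (Q w) := fun w => hg _
  set G : Y → Y := fun w => ε • w + Q (A (T w)) with hG
  have hGsub : ∀ w w', G w - G w' = ε • (w - w') + Q (A (T w) - A (T w')) := fun w w' => by
    rw [← hQsub]; simp only [hG]; module
  have hGm : StronglyMonotoneLipschitz ε (ε + ‖A‖ * (‖A‖ / μ)) G := by
    constructor
    · intro w w'
      have h1 := hF.mul_norm_sq_le_inner (hFT w) (hFT w')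
      rw [hGsub, inner_add_left, inner_smul_left, real_inner_self_eq_norm_sq, hQsymm, ← hQsub,
        real_inner_comm]
      simp only [conj_trivial]
      have : 0 ≤ μ * ‖T w - T w'‖ ^ 2 := by positivity
      linarith
    · intro w w'
      have h1 := hF.norm_sub_le_of_adjoint hμ (hFT w) (hFT w')
      rw [hQsub] at h1
      rw [hGsub]
      calc _ ≤ ‖ε • (w - w')‖ + ‖Q (A (T w) - A (T w'))‖ := norm_add_le _ _
        _ ≤ ε * ‖w - w'‖ + ‖A‖ * (‖A‖ / μ * ‖w - w'‖) := by
          refine add_le_add (by rw [norm_smul, Real.norm_of_nonneg hε.le]) ?_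
          refine (hQnorm _).trans ?_
          rw [← map_sub]
          refine (A.le_opNorm _).trans (mul_le_mul_of_nonneg_left (h1.trans ?_) (norm_nonneg _))
          exact mul_le_mul_of_nonneg_left (hQnorm _) (by positivity)
        _ = _ := by ring
  obtain ⟨w, hw⟩ := hGm.surjective hε (by positivity) 0
  have hw1 : Q (A (T w)) = -(ε • w) := by
    simp only [hG] at hw
    exact eq_neg_of_add_eq_zero_right hw
  have hskew : P w = -w := by
    have h1 := hPQ (A (T w))
    rw [hw1, map_neg, neg_inj, map_smul, ← smul_neg] at h1
    exact smul_right_injective Y hε.ne' h1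
  have hQw : Q w = w := by simp only [hQ, hskew]; module
  refine ⟨T w, w, by rw [hFT, hQw], hskew, ?_⟩
  have h1 : A (T w) - P (A (T w)) = -((2 * ε) • w) := by
    have h2 : (2 : ℝ) • Q (A (T w)) = A (T w) - P (A (T w)) := by simp only [hQ]; module
    rw [← h2, hw1]; module
  have h3 : P (A (T w)) = A (T w) + (2 * ε) • w := by
    rw [← sub_eq_zero, ← neg_eq_zero]
    have : -(P (A (T w)) - (A (T w) + (2 * ε) • w))
        = (A (T w) - P (A (T w))) + (2 * ε) • w := by module
    rw [this, h1]; module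
  rw [map_add, map_smul, hskew, h3]
  module

end Splitting

/-! ### One prediction-correction period. -/

section Recursion

variable {X Y : Type*} [NormedAddCommGroup X] [InnerProductSpace ℝ X] [CompleteSpace X]
  [NormedAddCommGroup Y] [InnerProductSpace ℝ Y] [CompleteSpace Y]

theorem kappaBar_eq {dM : ℕ} {μ ε : ℝ} : kappaBar dM μ ε = 1 + dM / μ / ε := by
  unfold kappaBar; rw [div_div]

theorem one_le_omega {dM : ℕ} {μ ε ρ : ℝ} (hμ : 0 < μ) (hε : 0 < ε) (hρ : 0 < ρ) :
    1 ≤ omega dM μ ρ ε := by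
  have h3 : 0 < 1 + ρ * muBar ε := by unfold muBar; positivity
  unfold omega
  rw [one_le_div h3]
  unfold LBar muBar
  have : 0 ≤ ρ * (dM / μ) := by positivity
  linarith

set_option maxHeartbeats 1000000 in
/-- Distance of the output of the prediction step to the next fixed point. -/
theorem prediction_error_le {F F' Fh : X → X} {A : X →L[ℝ] Y} {P : Y →L[ℝ] Y}
    {μ L ε ρ s R c : ℝ} {dM : ℕ} (hP : IsSymmetricInvolution P)
    (hF : StronglyMonotoneLipschitz μ L F)
    (hFh : StronglyMonotoneLipschitz μ L Fh) (hμ : 0 < μ) (hL : 0 < L) (hε : 0 < ε)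
    (hρ : 0 < ρ) (hs0 : 0 ≤ s) (hc : 0 ≤ c)
    (hA : ∀ x, ‖A x‖ ^ 2 ≤ dM * ‖x‖ ^ 2)
    (hs : ∀ w, P w = -w →
      (∀ v, P v = -v → ContinuousLinearMap.adjoint A v = 0 → inner ℝ w v = 0) →
      s * ‖w‖ ^ 2 ≤ ‖ContinuousLinearMap.adjoint A w‖ ^ 2)
    (hRm : 2 * R ≤ ε + μ * s / L ^ 2) (hRβ : 2 * R ≤ dM / μ) (hεβ : ε ≤ dM / μ)
    (hpert : ∀ x x', F x = F' x' → ‖A x - A x'‖ ≤ R * c)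
    {zk wk : Y} {xk : X} (hk : IsResolvent F A ε ρ zk xk wk)
    (hpred : ∀ y, Fh y = F xk → ‖A y - A xk‖ ≤ R * c)
    {xs xs' : X} {ws ws' : Y} (hsad : IsSaddle F A P ε xs ws) (hsad' : IsSaddle F' A P ε xs' ws')
    {zp wp : ℕ → Y} {xp : ℕ → X} (hp : ∀ ℓ, IsResolvent Fh A ε ρ (zp ℓ) (xp ℓ) (wp ℓ))
    (hzp : ∀ ℓ, zp (ℓ + 1) = -P ((2 : ℝ) • wp ℓ - zp ℓ)) (hzp0 : zp 0 = zk) (NP : ℕ) :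
    ‖zp NP - (ws' + ρ • (ε • ws' + A xs'))‖ ≤ (1 + ρ * LBar dM μ ε) *
      ((zeta dM μ ρ NP ε + 2 * kappaBar dM μ ε * xi dM μ ρ NP ε) * ‖wk - ws‖ +
        c * (zeta dM μ ρ NP ε + 2 * (1 + kappaBar dM μ ε * xi dM μ ρ NP ε))) := by
  set β : ℝ := dM / μ with hβ
  set Om : ℝ := 1 + ρ * LBar dM μ ε with hOm
  set m : ℝ := μ * s / L ^ 2 with hm
  set E : ℝ := ‖wk - ws‖ with hE
  set zS : Y := ws' + ρ • (ε • ws' + A xs') with hzS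
  have hβ0 : 0 < β := hε.trans_le hεβ
  have hm0 : 0 ≤ m := by positivity
  have hE0 : 0 ≤ E := norm_nonneg _
  have hOm1 : Om = 1 + ρ * ε + ρ * β := by rw [hOm]; unfold LBar; ring
  have hρβ : 0 < ρ * β := by positivity
  have hρε : 0 < ρ * ε := by positivity
  have hOm0 : 0 ≤ Om := by rw [hOm1]; positivity
  -- `x2` is the primal point that the old costs assign to the new dual solution.
  obtain ⟨x2, hx2⟩ := hF.surjective hμ hL (ContinuousLinearMap.adjoint A ws')
  have hx2' : ‖A x2 - A xs'‖ ≤ R * c := hpert x2 xs' (hx2.trans hsad'.stationary.symm)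
  -- Drift of the dual solution: the modulus `ε + m` absorbs `2R`, although `R` may exceed `ε`.
  have hσ : ‖ws - ws'‖ ≤ c / 2 := by
    have h1 := hsad.mul_norm_sub_le hP hF hμ hL hε hs hsad' hx2 hx2'
    have h2 : R * c ≤ (ε + m) * (c / 2) := by
      have := mul_le_mul_of_nonneg_right hRm hc
      linarith
    exact le_of_mul_le_mul_left (h1.trans h2) (by positivity)
  have hwk : ‖wk - ws'‖ ≤ E + c / 2 :=
    (norm_sub_le_norm_sub_add_norm_sub wk ws ws').trans (add_le_add le_rfl hσ)
  -- The intermediate point has the old costs' resolvent `ws'`, so the first leg is an `ε,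
  -- ρ`-resolvent comparison for one problem and the second is the time perturbation.
  have hzk : ‖zk - zS‖ ≤ Om * (E + c / 2) + ρ * (R * c) := by
    have hr2 : IsResolvent F A ε ρ ((1 + ε * ρ) • ws' + ρ • A x2) x2 ws' := ⟨hx2, rfl⟩
    have h1 := hk.norm_sub_le hF hμ hε hρ hA hr2
    have h2 : ((1 + ε * ρ) • ws' + ρ • A x2) - zS = ρ • (A x2 - A xs') := by
      rw [hzS]; module
    calc _ ≤ _ := norm_sub_le_norm_sub_add_norm_sub zk ((1 + ε * ρ) • ws' + ρ • A x2) zS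
      _ ≤ _ := by
        refine add_le_add (h1.trans (mul_le_mul_of_nonneg_left ‹_› hOm0)) ?_
        rw [h2, norm_smul, Real.norm_of_nonneg hρ.le]
        gcongr
  have hRc : ρ * (R * c) ≤ Om * c := by
    rw [hOm1]
    have h1 : ρ * R ≤ ρ * β := mul_le_mul_of_nonneg_left (by linarith) hρ.le
    have h2 := mul_le_mul_of_nonneg_right h1 hc
    have h3 : 0 ≤ (1 + ρ * ε) * c := by positivity
    linarith
  rcases Nat.eq_zero_or_pos NP with rfl | hNP
  · rw [hzp0]
    simp only [zeta, xi, if_true]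
    refine hzk.trans ?_
    have : 0 ≤ Om * c := by positivity
    linarith
  · obtain ⟨xh, wh, hh⟩ := exists_isSaddle (A := A) hP hFh hμ hL hε
    obtain ⟨y, hy⟩ := hFh.surjective hμ hL (ContinuousLinearMap.adjoint A ws')
    obtain ⟨yk, hyk⟩ := hFh.surjective hμ hL (F xk)
    have hyk' := hpred yk hyk
    rw [hk.stationary] at hyk
    -- Distance, after applying `A`, between the predicted and the true new primal point at `ws'`.
    -- The path passes through the dual point `wk`: each of the two legs in `w` costs `β‖wk - ws'‖`,
    -- and the change to predicted costs and the change of time cost `R * c` each.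
    set p : ℝ := 2 * β * (E + c / 2) + 2 * (R * c) with hp_def
    have hpb : ‖A y - A xs'‖ ≤ p := by
      have h1 := hFh.norm_map_sub_le hμ (Nat.cast_nonneg dM) hA hy hyk
      have h2 := hF.norm_map_sub_le hμ (Nat.cast_nonneg dM) hA hk.stationary hx2
      rw [norm_sub_rev ws' wk] at h1
      have h3 : β * ‖wk - ws'‖ ≤ β * (E + c / 2) := by gcongr
      have e : A y - A xs' = (A y - A yk) + (A yk - A xk) + (A xk - A x2) + (A x2 - A xs') := by
        abel
      rw [e]
      have h4 := norm_add₄_le (a := A y - A yk) (b := A yk - A xk) (c := A xk - A x2)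
        (d := A x2 - A xs')
      linarith
    have hτw : ‖wh - ws'‖ ≤ 2 * (β / ε) * (E + c / 2) + c := by
      have h1 := hh.mul_norm_sub_le hP hFh hμ hL hε hs hsad' hy hpb
      refine le_of_mul_le_mul_left (h1.trans ?_) (show 0 < ε + m by positivity)
      have e : ε * (β / ε) = β := by field_simp
      have h2 : 2 * (R * c) ≤ (ε + m) * c := by
        have := mul_le_mul_of_nonneg_right hRm hc
        linarith
      have h3 : 0 ≤ m * (2 * (β / ε) * (E + c / 2)) := by positivity
      have e2 : ε * (2 * (β / ε) * (E + c / 2)) = 2 * β * (E + c / 2) := by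
        rw [← e]; field_simp
      rw [hp_def]
      linarith
    set zH : Y := wh + ρ • (ε • wh + A xh) with hzH
    have hτz : ‖zH - zS‖ ≤ Om * (2 * kappaBar dM μ ε * (E + c)) := by
      have hr2 : IsResolvent Fh A ε ρ ((1 + ε * ρ) • ws' + ρ • A y) y ws' := ⟨hy, rfl⟩
      have h1 := (hh.isResolvent ρ).norm_sub_le hFh hμ hε hρ hA hr2
      have h2 : ((1 + ε * ρ) • ws' + ρ • A y) - zS = ρ • (A y - A xs') := by
        rw [hzS]; module
      have h3 : ‖zH - zS‖ ≤ Om * (2 * (β / ε) * (E + c / 2) + c) + ρ * p := by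
        calc _ ≤ _ := norm_sub_le_norm_sub_add_norm_sub zH ((1 + ε * ρ) • ws' + ρ • A y) zS
          _ ≤ _ := by
            refine add_le_add (h1.trans (mul_le_mul_of_nonneg_left ‹_› hOm0)) ?_
            rw [h2, norm_smul, Real.norm_of_nonneg hρ.le]
            gcongr
      refine h3.trans ?_
      have hq : 1 ≤ β / ε := by rwa [one_le_div hε]
      have h4 : ρ * (2 * β * (E + c / 2)) ≤ Om * (2 * (E + c / 2)) := by
        have : ρ * β ≤ Om := by rw [hOm1]; linarith
        have : ρ * β * (2 * (E + c / 2)) ≤ Om * (2 * (E + c / 2)) := by gcongr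
        linarith
      have h5 : ρ * (2 * (R * c)) ≤ Om * (β / ε * c) := by
        have h6 : ρ * (2 * R) ≤ Om := by
          have : ρ * (2 * R) ≤ ρ * β := by gcongr
          rw [hOm1]; linarith
        calc ρ * (2 * (R * c)) = ρ * (2 * R) * c := by ring
          _ ≤ Om * c := by gcongr
          _ ≤ Om * (β / ε * c) := by
            refine mul_le_mul_of_nonneg_left ?_ hOm0
            exact le_mul_of_one_le_left hc hq
      rw [kappaBar_eq, ← hβ, hp_def]
      linarith
    set Λ : ℝ := lam dM μ ρ ε ^ NP with hΛ
    have hΛ0 : 0 ≤ Λ := pow_nonneg lam_nonneg _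
    have hΛ1 : Λ ≤ 1 := pow_le_one₀ lam_nonneg (lam_le_one hμ hε hρ)
    -- The two phases are joined in the variable `z`, with no conversion to `w` in between. The
    -- factor `ω` in `ζ(N_P)` and `ξ(N_P)` is therefore slack.
    have hζ : Λ ≤ omega dM μ ρ ε * Λ := by
      have := one_le_omega (dM := dM) hμ hε hρ
      exact le_mul_of_one_le_left hΛ0 this
    simp only [zeta, xi, hNP.ne', if_false, ← hΛ]
    set ζ : ℝ := omega dM μ ρ ε * Λ with hζ_def
    have h1 := norm_iterate_sub_le hP hFh hμ hε hρ hA hp hzp (hh.isResolvent ρ) (hh.fixed ρ) NP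
    rw [hzp0, ← hzH, ← hΛ] at h1
    have h2 : ‖zk - zH‖ ≤ ‖zk - zS‖ + ‖zH - zS‖ := by
      rw [norm_sub_rev zH zS]; exact norm_sub_le_norm_sub_add_norm_sub zk zS zH
    have h3 := norm_sub_le_norm_sub_add_norm_sub (zp NP) zH zS
    set τ : ℝ := ‖zH - zS‖ with hτ
    have h4 : ‖zp NP - zS‖ ≤ Λ * (Om * (E + c / 2) + ρ * (R * c)) + (1 + Λ) * τ := by
      have : Λ * ‖zk - zH‖ ≤ Λ * (‖zk - zS‖ + τ) := by gcongr
      have : Λ * ‖zk - zS‖ ≤ Λ * (Om * (E + c / 2) + ρ * (R * c)) := by gcongr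
      linarith
    have h5 : Λ * (Om * (E + c / 2)) ≤ ζ * (Om * (E + c)) := by
      have : Om * (E + c / 2) ≤ Om * (E + c) := by gcongr; linarith
      have h0 : 0 ≤ Om * (E + c / 2) := by positivity
      exact mul_le_mul hζ this h0 (hΛ0.trans hζ)
    have h6 : Λ * (ρ * (R * c)) ≤ Om * c := by
      have : 0 ≤ Om * c := by positivity
      exact (mul_le_mul_of_nonneg_left hRc hΛ0).trans (mul_le_of_le_one_left this hΛ1)
    have h7 : (1 + Λ) * τ ≤ (1 + ζ) * (Om * (2 * kappaBar dM μ ε * (E + c))) :=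
      mul_le_mul (by linarith) hτz (norm_nonneg _) (by linarith)
    have h8 : 0 ≤ Om * c := by positivity
    linarith

/-- One period of prediction and correction. -/
theorem tracking_error_le {F F' Fh : X → X} {A : X →L[ℝ] Y} {P : Y →L[ℝ] Y}
    {μ L ε ρ s R c : ℝ} {dM : ℕ} (hP : IsSymmetricInvolution P)
    (hF : StronglyMonotoneLipschitz μ L F) (hF' : StronglyMonotoneLipschitz μ L F')
    (hFh : StronglyMonotoneLipschitz μ L Fh) (hμ : 0 < μ) (hL : 0 < L) (hε : 0 < ε)
    (hρ : 0 < ρ) (hs0 : 0 ≤ s) (hc : 0 ≤ c)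
    (hA : ∀ x, ‖A x‖ ^ 2 ≤ dM * ‖x‖ ^ 2)
    (hs : ∀ w, P w = -w →
      (∀ v, P v = -v → ContinuousLinearMap.adjoint A v = 0 → inner ℝ w v = 0) →
      s * ‖w‖ ^ 2 ≤ ‖ContinuousLinearMap.adjoint A w‖ ^ 2)
    (hRm : 2 * R ≤ ε + μ * s / L ^ 2) (hRβ : 2 * R ≤ dM / μ) (hεβ : ε ≤ dM / μ)
    (hpert : ∀ x x', F x = F' x' → ‖A x - A x'‖ ≤ R * c)
    {zk wk : Y} {xk : X} (hk : IsResolvent F A ε ρ zk xk wk)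
    (hpred : ∀ y, Fh y = F xk → ‖A y - A xk‖ ≤ R * c)
    {xs xs' : X} {ws ws' : Y} (hsad : IsSaddle F A P ε xs ws) (hsad' : IsSaddle F' A P ε xs' ws')
    {zp wp : ℕ → Y} {xp : ℕ → X} (hp : ∀ ℓ, IsResolvent Fh A ε ρ (zp ℓ) (xp ℓ) (wp ℓ))
    (hzp : ∀ ℓ, zp (ℓ + 1) = -P ((2 : ℝ) • wp ℓ - zp ℓ)) (hzp0 : zp 0 = zk) (NP : ℕ)
    {zc wc : ℕ → Y} {xc : ℕ → X} (hcr : ∀ ℓ, IsResolvent F' A ε ρ (zc ℓ) (xc ℓ) (wc ℓ))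
    (hzc : ∀ ℓ, zc (ℓ + 1) = -P ((2 : ℝ) • wc ℓ - zc ℓ)) (hzc0 : zc 0 = zp NP) {NC : ℕ}
    (hNC : NC ≠ 0) :
    ‖wc NC - ws'‖ ≤ zeta dM μ ρ NC ε *
      ((zeta dM μ ρ NP ε + 2 * kappaBar dM μ ε * xi dM μ ρ NP ε) * ‖wk - ws‖ +
        c * (zeta dM μ ρ NP ε + 2 * (1 + kappaBar dM μ ε * xi dM μ ρ NP ε))) := by
  have h1 := prediction_error_le hP hF hFh hμ hL hε hρ hs0 hc hA hs hRm hRβ hεβ hpert hk hpred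
    hsad hsad' hp hzp hzp0 NP
  have h2 := norm_iterate_sub_le hP hF' hμ hε hρ hA hcr hzc (hsad'.isResolvent ρ)
    (hsad'.fixed ρ) NC
  have h3 := (hcr NC).mul_norm_sub_le hF' hμ hρ (hsad'.isResolvent ρ)
  rw [hzc0] at h2
  have h4 := h3.trans (h2.trans (mul_le_mul_of_nonneg_left h1 (pow_nonneg lam_nonneg _)))
  have h5 : 0 < 1 + ρ * ε := by positivity
  rw [mul_comm, ← le_div_iff₀ h5] at h4
  refine h4.trans_eq ?_
  -- The constants of the passage from `w` to `z` at the start and back at the end combine to the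
  -- `ω` in `ζ(N_C)`. For `NC = 0` this factor would be missing.
  have h6 : zeta dM μ ρ NC ε = (1 + ρ * LBar dM μ ε) / (1 + ρ * ε) * lam dM μ ρ ε ^ NC := if_neg hNC
  rw [h6]
  ring

end Recursion

/-! ### Local costs, Hessians and predicted costs. -/

section NodeCosts

variable {n : ℕ} {μ L : ℝ} {g : Vec n → ℝ}

namespace IsStronglyConvexSmooth

/-- Divide the strong convexity inequality on the segment from `x` to `y` by its parameter `t` and
let `t` decrease to `0`. -/
theorem add_inner_add_sq_le (hg : IsStronglyConvexSmooth μ L g) (x y : Vec n) :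
    g x + inner ℝ (gradient g x) (y - x) + μ / 2 * ‖y - x‖ ^ 2 ≤ g y := by
  have hd : HasDerivAt (fun t : ℝ => g (x + t • (y - x))) (inner ℝ (gradient g x) (y - x)) 0 := by
    have h1 : HasFDerivAt g (InnerProductSpace.toDual ℝ _ (gradient g x)) (x + (0 : ℝ) • (y - x)) := by
      simpa using (hg.differentiable x).hasGradientAt.hasFDerivAt
    have h2 : HasDerivAt (fun t : ℝ => x + t • (y - x)) (y - x) 0 := by
      simpa using ((hasDerivAt_id (0 : ℝ)).smul_const (y - x)).const_add x
    have h3 := h1.comp_hasDerivAt (0 : ℝ) h2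
    rw [InnerProductSpace.toDual_apply_apply] at h3
    exact h3
  have hlim : Tendsto (fun t : ℝ => t⁻¹ • (g (x + t • (y - x)) - g x)) (𝓝[>] 0)
      (𝓝 (inner ℝ (gradient g x) (y - x))) := by
    have := hd.tendsto_slope_zero_right
    simpa using this
  have hlim2 : Tendsto (fun t : ℝ => (g y - g x) - (1 - t) * (μ / 2 * ‖y - x‖ ^ 2)) (𝓝[>] 0)
      (𝓝 ((g y - g x) - (1 - 0) * (μ / 2 * ‖y - x‖ ^ 2))) := by
    refine Tendsto.mono_left (Continuous.tendsto ?_ _) nhdsWithin_le_nhds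
    fun_prop
  have hle := le_of_tendsto_of_tendsto hlim hlim2 (by
    filter_upwards [Ioo_mem_nhdsGT (zero_lt_one : (0 : ℝ) < 1)] with t ht
    have h3 := hg.strongConvex.2 (mem_univ x) (mem_univ y) (sub_nonneg.2 ht.2.le) ht.1.le
      (sub_add_cancel 1 t)
    have e : (1 - t) • x + t • y = x + t • (y - x) := by module
    rw [e, norm_sub_rev x y] at h3
    simp only [smul_eq_mul] at h3 ⊢
    rw [inv_mul_le_iff₀ ht.1]
    linarith)
  linarith

/-- Using `max L μ` supplies a positive Lipschitz constant without any assumption on the sign of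
`L`. -/
theorem gradient_lipschitz (hg : IsStronglyConvexSmooth μ L g) :
    StronglyMonotoneLipschitz μ (max L μ) (gradient g) where
  mono x y := by
    have h1 := hg.add_inner_add_sq_le x y
    have h2 := hg.add_inner_add_sq_le y x
    have e : inner ℝ (gradient g x) (y - x) = - inner ℝ (gradient g x) (x - y) := by
      rw [← inner_neg_right, neg_sub]
    rw [e, norm_sub_rev y x] at h1
    rw [inner_sub_left]
    linarith
  lip x y := (hg.lipschitz_gradient x y).trans
    (mul_le_mul_of_nonneg_right (le_max_left _ _) (norm_nonneg _))

theorem mul_norm_sq_le_inner_hessian (hg : IsStronglyConvexSmooth μ L g)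
    (hd : Differentiable ℝ (gradient g)) (x v : Vec n) :
    μ * ‖v‖ ^ 2 ≤ inner ℝ v (hessian g x v) := by
  have h1 : HasDerivAt (fun t : ℝ => gradient g (x + t • v)) (hessian g x v) 0 := by
    have h1 : HasFDerivAt (gradient g) (hessian g x) (x + (0 : ℝ) • v) := by
      rw [zero_smul, add_zero]
      exact (hd x).hasFDerivAt
    have h2 : HasDerivAt (fun t : ℝ => x + t • v) v 0 := by
      simpa using ((hasDerivAt_id (0 : ℝ)).smul_const v).const_add x
    exact h1.comp_hasDerivAt (0 : ℝ) h2
  have h2 := h1.tendsto_slope_zero_right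
  have h3 := (tendsto_const_nhds (x := v)).inner (𝕜 := ℝ) h2
  refine ge_of_tendsto h3 ?_
  filter_upwards [self_mem_nhdsWithin] with t ht
  have ht' : (0 : ℝ) < t := ht
  have h4 := hg.gradient_lipschitz.mono (x + t • v) x
  rw [add_sub_cancel_left, norm_smul, mul_pow, Real.norm_eq_abs, sq_abs, inner_smul_right,
    real_inner_comm] at h4
  simp only [zero_add, zero_smul, add_zero, inner_smul_right]
  rw [← div_eq_inv_mul, le_div_iff₀ ht']
  refine le_of_mul_le_mul_left ?_ ht'
  linarith

theorem norm_hessian_le (hg : IsStronglyConvexSmooth μ L g) (hμ : 0 < μ)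
    (hd : Differentiable ℝ (gradient g)) (x : Vec n) : ‖hessian g x‖ ≤ max L μ := by
  have h0 : 0 ≤ max L μ := le_max_of_le_right hμ.le
  have := (hd x).hasFDerivAt.le_of_lipschitz (C := ⟨max L μ, h0⟩)
    (LipschitzWith.of_dist_le_mul fun a b => by
      rw [dist_eq_norm, dist_eq_norm]; exact hg.gradient_lipschitz.lip a b)
  exact this

end IsStronglyConvexSmooth

/-- The symmetric part of an endomorphism. -/
noncomputable def symmPart (H : Vec n →L[ℝ] Vec n) : Vec n →L[ℝ] Vec n :=
  (1 / 2 : ℝ) • (H + ContinuousLinearMap.adjoint H)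

theorem inner_symmPart (H : Vec n →L[ℝ] Vec n) (v : Vec n) :
    inner ℝ (symmPart H v) v = inner ℝ v (H v) := by
  simp only [symmPart, smul_apply, add_apply,
    inner_smul_left, inner_add_left, ContinuousLinearMap.adjoint_inner_left, conj_trivial]
  rw [real_inner_comm]; ring

theorem norm_symmPart_le (H : Vec n →L[ℝ] Vec n) : ‖symmPart H‖ ≤ ‖H‖ := by
  have h := norm_add_le H (ContinuousLinearMap.adjoint H)
  rw [LinearIsometryEquiv.norm_map] at h
  rw [symmPart, norm_smul]
  norm_num
  linarith

theorem hasGradientAt_predictedCost (g : ℝ → Vec n → ℝ) (t Ts : ℝ) (x₀ v : Vec n) :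
    HasGradientAt (predictedCost g t Ts x₀)
      (gradient (g t) x₀ + symmPart (hessian (g t) x₀) (v - x₀) + Ts • mixedDeriv g t x₀) v := by
  have hid : HasFDerivAt (fun v : Vec n => v - x₀) (ContinuousLinearMap.id ℝ (Vec n)) v :=
    (hasFDerivAt_id v).sub_const x₀
  have h1 := (hasFDerivAt_const (gradient (g t) x₀) v).inner ℝ hid
  have h2 := hid.inner ℝ ((hessian (g t) x₀).hasFDerivAt.comp v hid)
  have h3 := (hasFDerivAt_const (mixedDeriv g t x₀) v).inner ℝ hid
  have h4 := ((h1.const_add (g t x₀)).add (h2.const_mul (1 / 2))).add (h3.const_mul Ts)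
  rw [hasGradientAt_iff_hasFDerivAt]
  refine h4.congr_fderiv ?_
  ext u
  simp [symmPart, ContinuousLinearMap.adjoint_inner_left, fderivInnerCLM_apply, -map_sub]
  rw [real_inner_comm u]
  ring

theorem gradient_predictedCost (g : ℝ → Vec n → ℝ) (t Ts : ℝ) (x₀ v : Vec n) :
    gradient (predictedCost g t Ts x₀) v =
      gradient (g t) x₀ + symmPart (hessian (g t) x₀) (v - x₀) + Ts • mixedDeriv g t x₀ :=
  (hasGradientAt_predictedCost g t Ts x₀ v).gradient

/-- The gradient is affine with linear part `symmPart` of the Hessian. A quadratic form sees only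
the symmetric part of its matrix, so symmetry of the Hessian need not be known. -/
theorem predictedCost_stronglyMonotone {g : ℝ → Vec n → ℝ} {t : ℝ}
    (hg : IsStronglyConvexSmooth μ L (g t)) (hμ : 0 < μ) (hd : Differentiable ℝ (gradient (g t)))
    (Ts : ℝ) (x₀ : Vec n) :
    StronglyMonotoneLipschitz μ (max L μ) (gradient (predictedCost g t Ts x₀)) := by
  have e : ∀ x y, gradient (predictedCost g t Ts x₀) x - gradient (predictedCost g t Ts x₀) y
      = symmPart (hessian (g t) x₀) (x - y) := fun x y => by
    rw [gradient_predictedCost, gradient_predictedCost]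
    have : x - y = (x - x₀) - (y - x₀) := by abel
    rw [this, map_sub _ (x - x₀) (y - x₀)]; abel
  constructor
  · intro x y
    rw [e, inner_symmPart]
    exact hg.mul_norm_sq_le_inner_hessian hd x₀ (x - y)
  · intro x y
    rw [e]
    refine (ContinuousLinearMap.le_opNorm _ _).trans ?_
    exact mul_le_mul_of_nonneg_right
      ((norm_symmPart_le _).trans (hg.norm_hessian_le hμ hd x₀)) (norm_nonneg _)

theorem CostAssumption.norm_gradient_sub_le {V : Type*} {f : V → ℝ → Vec n → ℝ} {C₀ : ℝ}
    (hf : CostAssumption f μ L C₀) (i : V) (x : Vec n) {t t' : ℝ} (ht : 0 ≤ t) (ht' : 0 ≤ t') :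
    ‖gradient (f i t') x - gradient (f i t) x‖ ≤ C₀ * |t' - t| :=
  (convex_Ici (0 : ℝ)).norm_image_sub_le_of_norm_derivWithin_le (hf.mixed_exists i x)
    (fun s hs => hf.mixed_bound i x s hs) ht ht'

end NodeCosts

/-! ### Separable costs on the product of the nodes. -/

section NodeSpaces

variable {V : Type*} [Fintype V] {n : ℕ} {μ L : ℝ}

/-- The gradient of `totalCost φ`. -/
noncomputable def totalGradient (φ : V → Vec n → ℝ) (x : NodeSpace V n) : NodeSpace V n :=
  WithLp.toLp 2 (fun i => gradient (φ i) (x i))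

theorem nodeSpace_inner (x y : NodeSpace V n) : inner ℝ x y = ∑ i, inner ℝ (x i) (y i) :=
  PiLp.inner_apply x y

theorem nodeSpace_norm_sq (x : NodeSpace V n) : ‖x‖ ^ 2 = ∑ i, ‖x i‖ ^ 2 :=
  PiLp.norm_sq_eq_of_L2 _ x

theorem totalGradient_stronglyMonotone {φ : V → Vec n → ℝ} (hL : 0 ≤ L)
    (hφ : ∀ i, StronglyMonotoneLipschitz μ L (gradient (φ i))) :
    StronglyMonotoneLipschitz μ L (totalGradient φ) := by
  constructor
  · intro x y
    rw [nodeSpace_inner, nodeSpace_norm_sq, Finset.mul_sum]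
    exact Finset.sum_le_sum fun i _ => (hφ i).mono (x i) (y i)
  · intro x y
    refine abs_le_of_sq_le_sq' ?_ (mul_nonneg hL (norm_nonneg _)) |>.2
    rw [mul_pow, nodeSpace_norm_sq, nodeSpace_norm_sq, Finset.mul_sum]
    refine Finset.sum_le_sum fun i _ => ?_
    rw [← mul_pow]
    exact pow_le_pow_left₀ (norm_nonneg _) ((hφ i).lip (x i) (y i)) 2

theorem totalCost_add_inner_add_sq_le {φ : V → Vec n → ℝ}
    (hφ : ∀ i, IsStronglyConvexSmooth μ L (φ i)) (x y : NodeSpace V n) :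
    totalCost φ x + inner ℝ (totalGradient φ x) (y - x) + μ / 2 * ‖y - x‖ ^ 2 ≤ totalCost φ y := by
  rw [nodeSpace_inner, nodeSpace_norm_sq, Finset.mul_sum]
  unfold totalCost
  rw [← Finset.sum_add_distrib, ← Finset.sum_add_distrib]
  exact Finset.sum_le_sum fun i _ => (hφ i).add_inner_add_sq_le (x i) (y i)

theorem nodeSpace_norm_le {x : NodeSpace V n} {a : ℝ} (ha : 0 ≤ a) (h : ∀ i, ‖x i‖ ≤ a) :
    ‖x‖ ≤ Real.sqrt (Fintype.card V) * a := by
  refine abs_le_of_sq_le_sq' ?_ (by positivity) |>.2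
  rw [nodeSpace_norm_sq, mul_pow, Real.sq_sqrt (Nat.cast_nonneg _)]
  refine (Finset.sum_le_sum fun i _ => pow_le_pow_left₀ (norm_nonneg _) (h i) 2).trans_eq ?_
  simp

end NodeSpaces

/-! ### The ADMM update as a reflection. -/

section Updates

variable {V : Type*} (G : SimpleGraph V) {n : ℕ}

/-- The dual variable of a local update. -/
noncomputable def dualVariable (ε ρ : ℝ) (z : EdgeSpace G n) (x : NodeSpace V n) : EdgeSpace G n :=
  delta ε ρ • (z - ρ • A G n x)

theorem auxUpdate_eq (ε ρ : ℝ) (z : EdgeSpace G n) (x : NodeSpace V n) :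
    auxUpdate G ε ρ z x = -P G n ((2 : ℝ) • dualVariable G ε ρ z x - z) := by
  ext e : 1
  change (1 - 2 * delta ε ρ) • z e.symm + (2 * delta ε ρ * ρ) • x e.snd =
    -((2 : ℝ) • (delta ε ρ • (z e.symm - ρ • x e.symm.fst)) - z e.symm)
  have : e.symm.fst = e.snd := rfl
  rw [this]
  module

end Updates

/-! ### The maps `A` and `P`, and local updates as resolvents. -/

section EdgeSpaces

variable {V : Type*} [Fintype V] (G : SimpleGraph V) [DecidableRel G.Adj] {n : ℕ}

theorem edgeSpace_inner (x y : EdgeSpace G n) : inner ℝ x y = ∑ e, inner ℝ (x e) (y e) :=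
  PiLp.inner_apply x y

theorem edgeSpace_norm_sq (x : EdgeSpace G n) : ‖x‖ ^ 2 = ∑ e, ‖x e‖ ^ 2 :=
  PiLp.norm_sq_eq_of_L2 _ x

theorem P_isSymmetricInvolution : IsSymmetricInvolution (P G n) := by
  constructor
  · intro y
    ext e : 1
    change y e.symm.symm = y e
    rw [SimpleGraph.Dart.symm_symm]
  · intro y y'
    rw [edgeSpace_inner, edgeSpace_inner]
    refine Fintype.sum_equiv (Equiv.ofBijective _ SimpleGraph.Dart.symm_involutive.bijective) _ _
      fun e => ?_
    change inner ℝ (y e.symm) (y' e) = inner ℝ (y e.symm) (y' e.symm.symm)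
    rw [SimpleGraph.Dart.symm_symm]

variable [DecidableEq V]

theorem sum_dart_eq {M : Type*} [AddCommMonoid M] (k : G.Dart → M) :
    ∑ e, k e = ∑ i, ∑ e : G.Dart with e.fst = i, k e :=
  (Finset.sum_fiberwise _ _ _).symm

theorem adjoint_A_apply (w : EdgeSpace G n) (i : V) :
    ContinuousLinearMap.adjoint (A G n) w i = ∑ e : G.Dart with e.fst = i, w e := by
  have h : ContinuousLinearMap.adjoint (A G n) w
      = WithLp.toLp 2 (fun i => ∑ e : G.Dart with e.fst = i, w e) := by
    refine ext_inner_right ℝ fun v => ?_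
    rw [ContinuousLinearMap.adjoint_inner_left, edgeSpace_inner, nodeSpace_inner, sum_dart_eq]
    refine Finset.sum_congr rfl fun i _ => ?_
    change _ = inner ℝ (∑ e : G.Dart with e.fst = i, w e) (v i)
    rw [sum_inner]
    refine Finset.sum_congr rfl fun e he => ?_
    change inner ℝ (w e) (v e.fst) = _
    rw [(Finset.mem_filter.1 he).2]
  rw [h]

theorem sum_dart_fst {M : Type*} [AddCommMonoid M] (k : V → M) (i : V) :
    ∑ e : G.Dart with e.fst = i, k e.fst = G.degree i • k i := by
  rw [← G.dart_fst_fiber_card_eq_degree i, ← Finset.sum_const]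
  exact Finset.sum_congr rfl fun e he => by rw [(Finset.mem_filter.1 he).2]

theorem norm_sq_A_le (x : NodeSpace V n) : ‖A G n x‖ ^ 2 ≤ G.maxDegree * ‖x‖ ^ 2 := by
  rw [edgeSpace_norm_sq, nodeSpace_norm_sq, sum_dart_eq, Finset.mul_sum]
  refine Finset.sum_le_sum fun i _ => ?_
  change ∑ e : G.Dart with e.fst = i, ‖x e.fst‖ ^ 2 ≤ _
  rw [sum_dart_fst G (fun j => ‖x j‖ ^ 2), nsmul_eq_mul]
  exact mul_le_mul_of_nonneg_right (by exact_mod_cast G.degree_le_maxDegree i) (sq_nonneg _)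

/-- Fermat's rule at each node: `(AᵀA x)_i = d_i x_i`, so the stationarity condition reads
`∇φ_i(x_i) = (Aᵀ δ(z - ρAx))_i`. -/
theorem IsLocalUpdate.isResolvent {φ : V → Vec n → ℝ} {ε ρ : ℝ} {z : EdgeSpace G n}
    {x : NodeSpace V n} (hφ : ∀ i, Differentiable ℝ (φ i)) (hε : 0 < ε) (hρ : 0 < ρ)
    (h : IsLocalUpdate G φ ε ρ z x) :
    IsResolvent (totalGradient φ) (A G n) ε ρ z x (dualVariable G ε ρ z x) := by
  have hpos : 1 + ε * ρ ≠ 0 := by positivity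
  constructor
  · ext i : 1
    set Z : Vec n := ∑ e : G.Dart with e.fst = i, z e with hZ
    have hgr : HasGradientAt (fun v : Vec n => φ i v + ρ * delta ε ρ * (G.degree i : ℝ) / 2 * ‖v‖ ^ 2
        - delta ε ρ * inner ℝ v Z)
        (gradient (φ i) (x i) + (ρ * delta ε ρ * (G.degree i : ℝ)) • x i - delta ε ρ • Z) (x i) := by
      rw [hasGradientAt_iff_hasFDerivAt]
      have h1 := (hφ i (x i)).hasGradientAt.hasFDerivAt
      have h2 := (hasStrictFDerivAt_norm_sq (x i)).hasFDerivAt.const_mul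
        (ρ * delta ε ρ * (G.degree i : ℝ) / 2)
      have h3 := ((hasFDerivAt_id (x i)).inner ℝ (hasFDerivAt_const Z (x i))).const_mul (delta ε ρ)
      refine ((h1.add h2).sub h3).congr_fderiv ?_
      ext u
      simp [fderivInnerCLM_apply]
      rw [real_inner_comm u Z]
      ring
    have h0 := ((h i).isLocalMin univ_mem).hasFDerivAt_eq_zero hgr.hasFDerivAt
    have h1 : gradient (φ i) (x i) + (ρ * delta ε ρ * (G.degree i : ℝ)) • x i - delta ε ρ • Z = 0 := by
      exact (LinearIsometryEquiv.map_eq_zero_iff _).1 h0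
    rw [adjoint_A_apply]
    change gradient (φ i) (x i) =
      ∑ e : G.Dart with e.fst = i, delta ε ρ • (z e - ρ • x e.fst)
    rw [← Finset.smul_sum, Finset.sum_sub_distrib, ← hZ, sum_dart_fst G (fun j => ρ • x j),
      ← Nat.cast_smul_eq_nsmul ℝ]
    rw [← sub_eq_zero, ← h1]
    module
  · unfold dualVariable delta
    rw [smul_smul, mul_one_div_cancel hpos]
    module

end EdgeSpaces

/-- The polynomial has its minimum at `t = 0`, so its slope there vanishes. The test value is chosen
so small that the linear term dominates. -/
theorem eq_zero_of_forall_mul_add_sq_nonneg {a b : ℝ} (h : ∀ t : ℝ, 0 ≤ t * a + t ^ 2 * b) :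
    a = 0 := by
  by_contra ha
  have hB : (0 : ℝ) < |b| + 1 := by positivity
  have h1 := h (-a / (|b| + 1) / 2)
  have e : -a / (|b| + 1) / 2 * a + (-a / (|b| + 1) / 2) ^ 2 * b
      = (a ^ 2 / (4 * (|b| + 1) ^ 2)) * (b - 2 * (|b| + 1)) := by
    field_simp; ring
  rw [e] at h1
  have h2 : 0 < a ^ 2 / (4 * (|b| + 1) ^ 2) := by positivity
  have h3 : b - 2 * (|b| + 1) < 0 := by
    have := le_abs_self b
    have := abs_nonneg b
    linarith
  exact absurd h1 (not_le.2 (mul_neg_of_pos_of_neg h2 h3))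

/-! ### Optimality conditions and regularization error. -/

section Duality

variable {V : Type*} [Fintype V] {G : SimpleGraph V} [DecidableRel G.Adj] {n : ℕ}
  {μ L ε : ℝ} {φ : V → Vec n → ℝ} {w : EdgeSpace G n}

/-- Half of the fact that `h⋆(-w)` is the indicator of the skew vectors: `w` is orthogonal to `ker
(I - P)`. -/
theorem conjugate_h_of_skew (hw : P G n w = -w) : conjugate (h G n) (-w) ≤ 0 := by
  refine iSup_le fun y => ?_
  by_cases hy : y - P G n y = 0
  · have h1 := (P_isSymmetricInvolution G).inner_eq_zero hw (sub_eq_zero.1 hy).symm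
    rw [inner_neg_left, real_inner_comm, h1]
    simp [h, hy]
  · simp [h, hy]

/-- A comparison of real numbers that expresses minimality of `w`. -/
theorem IsDualSolution.le (hw : IsDualSolution G φ ε w) (x : NodeSpace V n) {y : EdgeSpace G n}
    (hy : P G n y = y) {w' : EdgeSpace G n} (hw' : P G n w' = -w') {r : ℝ}
    (hr : ∀ v, inner ℝ (ContinuousLinearMap.adjoint (A G n) w') v - totalCost φ v ≤ r) :
    ε / 2 * ‖w‖ ^ 2 + (inner ℝ (ContinuousLinearMap.adjoint (A G n) w) x - totalCost φ x)
      - inner ℝ w y ≤ ε / 2 * ‖w'‖ ^ 2 + r := by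
  have h1 : dualObjective G φ ε w ≤ dualObjective G φ ε w' := hw (mem_univ w')
  have h2 : dualObjective G φ ε w' ≤ ((ε / 2 * ‖w'‖ ^ 2 : ℝ) : EReal) + (r : EReal) + 0 := by
    refine add_le_add (add_le_add le_rfl (iSup_le fun v => ?_)) (conjugate_h_of_skew hw')
    rw [← EReal.coe_sub]
    exact EReal.coe_le_coe_iff.2 (hr v)
  have h3 : ((ε / 2 * ‖w‖ ^ 2 : ℝ) : EReal)
      + ((inner ℝ (ContinuousLinearMap.adjoint (A G n) w) x - totalCost φ x : ℝ) : EReal)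
      + ((- inner ℝ w y : ℝ) : EReal) ≤ dualObjective G φ ε w := by
    refine add_le_add (add_le_add le_rfl ?_) ?_
    · rw [EReal.coe_sub]
      exact le_iSup (fun v : NodeSpace V n =>
        ((inner ℝ (ContinuousLinearMap.adjoint (A G n) w) v : ℝ) : EReal) - totalCost φ v) x
    · refine le_trans (le_of_eq ?_) (le_iSup (fun v : EdgeSpace G n =>
        ((inner ℝ (-w) v : ℝ) : EReal) - h G n v) y)
      have : y - P G n y = 0 := by rw [hy, sub_self]
      simp [h, this, inner_neg_left]
  have h4 := h3.trans (h1.trans h2)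
  rw [add_zero, ← EReal.coe_add, ← EReal.coe_add, ← EReal.coe_add, EReal.coe_le_coe_iff] at h4
  linarith

/-- Solutions of the dual problem satisfy the optimality conditions. -/
theorem IsDualSolution.exists_isSaddle (hμ : 0 < μ) (hφ : ∀ i, IsStronglyConvexSmooth μ L (φ i))
    (hw : IsDualSolution G φ ε w) :
    ∃ x, IsSaddle (totalGradient φ) (A G n) (P G n) ε x w := by
  have hP := P_isSymmetricInvolution (n := n) G
  have hmax : 0 < max L μ := lt_max_of_lt_right hμ
  have hF := totalGradient_stronglyMonotone hmax.le fun i => (hφ i).gradient_lipschitz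
  -- Upper bound for the conjugate of the cost at `∇f(x) + u`, quadratic in `u`. It replaces
  -- differentiability of the conjugate in the variations below.
  have hval : ∀ x y : NodeSpace V n, ∀ u : NodeSpace V n,
      inner ℝ (totalGradient φ x + u) y - totalCost φ y ≤
        inner ℝ (totalGradient φ x) x - totalCost φ x + inner ℝ u x + ‖u‖ ^ 2 / (2 * μ) := by
    intro x y u
    have h1 := totalCost_add_inner_add_sq_le hφ x y
    have h2 := real_inner_le_norm u (y - x)
    have h3 : ‖u‖ * ‖y - x‖ ≤ ‖u‖ ^ 2 / (2 * μ) + μ / 2 * ‖y - x‖ ^ 2 := by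
      have : 0 ≤ (‖u‖ - μ * ‖y - x‖) ^ 2 / (2 * μ) := by positivity
      have e : (‖u‖ - μ * ‖y - x‖) ^ 2 / (2 * μ)
          = ‖u‖ ^ 2 / (2 * μ) + μ / 2 * ‖y - x‖ ^ 2 - ‖u‖ * ‖y - x‖ := by
        field_simp; ring
      linarith
    rw [inner_sub_right] at h1 h2
    rw [inner_add_left]
    linarith
  have hskew : P G n w = -w := by
    obtain ⟨x0, hx0⟩ := hF.surjective hμ hmax 0
    set q : EdgeSpace G n := w + P G n w with hq
    have hPq : P G n q = q := by rw [hq, map_add, hP.invol, add_comm]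
    have hwq : inner ℝ w q = ‖q‖ ^ 2 / 2 := by
      have h1 := hP.symm w q
      rw [hPq] at h1
      have h2 : inner ℝ q q = inner ℝ w q + inner ℝ (P G n w) q := by
        rw [← inner_add_left]
      rw [h1, real_inner_self_eq_norm_sq] at h2
      linarith
    -- The dual value at `0` is finite, while a symmetric component `q` of `w` would let `-⟨w, t •
    -- q⟩` grow without bound in `h⋆(-w)`. An affine function of `t` that is bounded below is
    -- constant.
    have hlin : ∀ t : ℝ, 0 ≤ (ε / 2 * ‖(0 : EdgeSpace G n)‖ ^ 2 - totalCost φ x0)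
        - (ε / 2 * ‖w‖ ^ 2 + (inner ℝ (ContinuousLinearMap.adjoint (A G n) w) x0
          - totalCost φ x0)) + t * (‖q‖ ^ 2 / 2) := by
      intro t
      have h1 := hw.le (w' := 0) x0 (y := t • q) (by rw [map_smul, hPq]) (by simp)
        (r := - totalCost φ x0) (fun v => by
          have := hval x0 v 0
          rw [hx0] at this
          simpa using this)
      rw [inner_smul_right, hwq] at h1
      linarith
    have hq0 : ‖q‖ ^ 2 / 2 = 0 := by
      by_contra hne
      set k : ℝ := (ε / 2 * ‖(0 : EdgeSpace G n)‖ ^ 2 - totalCost φ x0)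
        - (ε / 2 * ‖w‖ ^ 2 + (inner ℝ (ContinuousLinearMap.adjoint (A G n) w) x0
          - totalCost φ x0))
      have h1 := hlin ((-k - 1) / (‖q‖ ^ 2 / 2))
      rw [div_mul_cancel₀ _ hne] at h1
      linarith
    have : q = 0 := by
      have : ‖q‖ ^ 2 = 0 := by linarith
      simpa using this
    exact eq_neg_of_add_eq_zero_right this
  obtain ⟨x, hx⟩ := hF.surjective hμ hmax (ContinuousLinearMap.adjoint (A G n) w)
  refine ⟨x, hx, hskew, ?_⟩
  set g : EdgeSpace G n := ε • w + A G n x with hg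
  -- First variation of the dual objective along skew directions, which keep the competitor
  -- feasible.
  have horth : ∀ v, P G n v = -v → inner ℝ g v = 0 := by
    intro v hv
    refine eq_zero_of_forall_mul_add_sq_nonneg
      (b := ε / 2 * ‖v‖ ^ 2 + ‖ContinuousLinearMap.adjoint (A G n) v‖ ^ 2 / (2 * μ)) fun t => ?_
    have h1 := hw.le (w' := w + t • v) x (y := 0) (by simp)
      (by rw [map_add, map_smul, hskew, hv]; module)
      (r := inner ℝ (totalGradient φ x) x - totalCost φ x
        + inner ℝ (ContinuousLinearMap.adjoint (A G n) (t • v)) x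
        + ‖ContinuousLinearMap.adjoint (A G n) (t • v)‖ ^ 2 / (2 * μ)) (fun y => by
          have := hval x y (ContinuousLinearMap.adjoint (A G n) (t • v))
          rwa [hx, ← map_add, ← hx] at this)
    rw [hx, norm_add_sq_real, inner_zero_right, map_smul, norm_smul, norm_smul, mul_pow, mul_pow,
      Real.norm_eq_abs, sq_abs, inner_smul_left, inner_smul_right,
      ContinuousLinearMap.adjoint_inner_left (A G n) x v] at h1
    simp only [conj_trivial] at h1
    have h2 : inner ℝ g v = ε * inner ℝ w v + inner ℝ v (A G n x) := by
      rw [hg, inner_add_left, inner_smul_left, real_inner_comm v (A G n x)]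
      simp
    rw [h2]
    have e : t ^ 2 * ‖ContinuousLinearMap.adjoint (A G n) v‖ ^ 2 / (2 * μ)
      = t ^ 2 * (‖ContinuousLinearMap.adjoint (A G n) v‖ ^ 2 / (2 * μ)) := by ring
    rw [e] at h1
    linarith
  have hv : P G n (g - P G n g) = -(g - P G n g) := by rw [map_sub, hP.invol]; abel
  have h1 := horth _ hv
  have h2 : inner ℝ (P G n g) (g - P G n g) = 0 := by
    rw [hP.symm, hv, inner_neg_right, h1, neg_zero]
  have h3 : ‖g - P G n g‖ ^ 2 = 0 := by
    rw [← real_inner_self_eq_norm_sq, inner_sub_left, h1, h2, sub_zero]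
  have h4 : g - P G n g = 0 := by simpa using h3
  exact (sub_eq_zero.1 h4).symm

/-- The primal solution is the primal point of any solution of the unregularized dual. -/
theorem IsPrimalSolution.eq_of_isSaddle {x xs : NodeSpace V n} (hμ : 0 < μ)
    (hφ : ∀ i, IsStronglyConvexSmooth μ L (φ i)) (hxs : IsPrimalSolution G φ xs)
    (hs : IsSaddle (totalGradient φ) (A G n) (P G n) 0 x w) : xs = x := by
  have hP := P_isSymmetricInvolution (n := n) G
  obtain ⟨y, hy, hmin⟩ := hxs
  rw [sub_eq_zero] at hy
  have hAx : P G n (A G n x) = A G n x := by simpa using hs.symm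
  have h1 : (totalCost φ xs : EReal) + h G n y ≤ (totalCost φ x : EReal) + h G n (A G n x) :=
    hmin (show (x, A G n x) ∈ {p : NodeSpace V n × EdgeSpace G n | A G n p.1 - p.2 = 0} from
      sub_self _)
  have h2 : h G n (A G n x) = 0 := by simp [h, hAx]
  rw [h2, add_zero] at h1
  by_cases hyP : y - P G n y = 0
  · have h3 : h G n y = 0 := by simp [h, hyP]
    rw [h3, add_zero, EReal.coe_le_coe_iff] at h1
    have h4 := totalCost_add_inner_add_sq_le hφ x xs
    have h5 : P G n (A G n (xs - x)) = A G n (xs - x) := by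
      rw [map_sub, map_sub, hAx, hy, (sub_eq_zero.1 hyP).symm]
    rw [hs.stationary, ContinuousLinearMap.adjoint_inner_left, real_inner_comm,
      hP.inner_eq_zero hs.skew h5] at h4
    have h6 : μ / 2 * ‖xs - x‖ ^ 2 ≤ 0 := by linarith
    have h7 : ‖xs - x‖ ^ 2 = 0 := by
      refine le_antisymm ?_ (sq_nonneg _)
      exact nonpos_of_mul_nonpos_right h6 (by positivity)
    exact sub_eq_zero.1 (by simpa using h7)
  · have h3 : h G n y = ⊤ := by simp [h, hyP]
    rw [h3, EReal.coe_add_top, top_le_iff] at h1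
    exact absurd h1 (EReal.coe_ne_top _)

/-- The regularization error of the dual solution is bounded by the norm of a dual solution. -/
theorem norm_sub_le_of_isSaddle {F : NodeSpace V n → NodeSpace V n} {x x' : NodeSpace V n}
    {w' : EdgeSpace G n} (hF : StronglyMonotoneLipschitz μ L F) (hμ : 0 < μ) (hε : 0 < ε)
    (hs : IsSaddle F (A G n) (P G n) ε x w) (hs' : IsSaddle F (A G n) (P G n) 0 x' w') :
    ‖w - w'‖ ≤ ‖w'‖ := by
  have hP := P_isSymmetricInvolution (n := n) G
  have hskew : P G n (w - w') = -(w - w') := by rw [map_sub, hs.skew, hs'.skew]; abel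
  have h1 := hP.inner_eq_zero hskew hs.symm
  have h2 := hP.inner_eq_zero hskew hs'.symm
  have h3 := hF.mul_norm_sq_le_inner hs.stationary hs'.stationary
  rw [zero_smul, zero_add] at h2
  rw [inner_add_left, inner_smul_left] at h1
  simp only [conj_trivial] at h1
  rw [inner_sub_right, real_inner_comm, real_inner_comm (A G n x') (w - w'), h2] at h3
  -- Monotonicity of `w ↦ Ax(w)` leaves only the regularization term. The angle condition then gives
  -- `‖w - w'‖² + ‖w‖² ≤ ‖w'‖²`.
  have h4 : inner ℝ w (w - w') ≤ 0 := by
    have h5 : ε * inner ℝ w (w - w') ≤ 0 := by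
      have : 0 ≤ μ * ‖x - x'‖ ^ 2 := by positivity
      linarith
    exact nonpos_of_mul_nonpos_right h5 hε
  refine abs_le_of_sq_le_sq' ?_ (norm_nonneg _) |>.2
  have h6 : ‖w'‖ ^ 2 = ‖w‖ ^ 2 - 2 * inner ℝ w (w - w') + ‖w - w'‖ ^ 2 := by
    rw [← norm_sub_sq_real, sub_sub_cancel]
  have := sq_nonneg ‖w‖
  linarith

/-- On the skew vectors orthogonal to the skew part of `ker Aᵀ` the map `Aᵀ` is injective, and an
injective linear map on a finite-dimensional space is bounded below. -/
theorem exists_mul_norm_sq_le_adjoint (G : SimpleGraph V) [DecidableRel G.Adj] (n : ℕ) :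
    ∃ s : ℝ, 0 < s ∧ ∀ w : EdgeSpace G n, P G n w = -w →
      (∀ v, P G n v = -v → ContinuousLinearMap.adjoint (A G n) v = 0 → inner ℝ w v = 0) →
      s * ‖w‖ ^ 2 ≤ ‖ContinuousLinearMap.adjoint (A G n) w‖ ^ 2 := by
  let W : Submodule ℝ (EdgeSpace G n) :=
    { carrier := {w | P G n w = -w ∧
        ∀ v, P G n v = -v → ContinuousLinearMap.adjoint (A G n) v = 0 → inner ℝ w v = 0}
      add_mem' := fun {a b} ha hb => ⟨by rw [map_add, ha.1, hb.1]; abel, fun v hv hv' => by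
        rw [inner_add_left, ha.2 v hv hv', hb.2 v hv hv', add_zero]⟩
      zero_mem' := ⟨by simp, fun v _ _ => inner_zero_left v⟩
      smul_mem' := fun c a ha => ⟨by rw [map_smul, ha.1, smul_neg], fun v hv hv' => by
        rw [inner_smul_left, ha.2 v hv hv', mul_zero]⟩ }
  let T : W →ₗ[ℝ] NodeSpace V n :=
    (ContinuousLinearMap.adjoint (A G n)).toLinearMap.comp W.subtype
  have hker : LinearMap.ker T = ⊥ := by
    rw [LinearMap.ker_eq_bot']
    intro w hw
    have h1 := w.2.2 w.1 w.2.1 hw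
    exact Subtype.ext (inner_self_eq_zero.1 h1)
  obtain ⟨K, hK, hT⟩ := T.exists_antilipschitzWith hker
  have hK' : (0 : ℝ) < K := by exact_mod_cast hK
  refine ⟨1 / (K : ℝ) ^ 2, by positivity, fun w hw hw' => ?_⟩
  have h1 : ‖w‖ ≤ K * ‖ContinuousLinearMap.adjoint (A G n) w‖ := by
    have := hT.le_mul_dist (⟨w, hw, hw'⟩ : W) 0
    rw [map_zero, dist_zero_right, dist_zero_right] at this
    exact this
  rw [one_div_mul_eq_div, div_le_iff₀ (by positivity)]
  calc ‖w‖ ^ 2 ≤ (K * ‖ContinuousLinearMap.adjoint (A G n) w‖) ^ 2 :=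
        pow_le_pow_left₀ (norm_nonneg _) h1 2
    _ = _ := by ring

end Duality

/-- Geometric recursions with a constant perturbation. -/
theorem limsup_le_of_affine_recursion {e E : ℕ → ℝ} {a b q r : ℝ} (he : ∀ k, 0 ≤ e k)
    (ha : 0 ≤ a) (hq0 : 0 ≤ q) (hq1 : q < 1) (heE : ∀ k, e (k + 1) ≤ a * (E (k + 1) + b))
    (hE : ∀ k, E (k + 2) ≤ q * E (k + 1) + r) :
    IsBoundedUnder (· ≤ ·) atTop e ∧ limsup e atTop ≤ a * (r / (1 - q) + b) := by
  have hq : 0 < 1 - q := by linarith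
  set s : ℝ := r / (1 - q) with hs
  have hsr : r = s - q * s := by rw [hs]; field_simp
  have hgeo : ∀ k, E (k + 1) ≤ q ^ k * (E 1 - s) + s := by
    intro k
    induction k with
    | zero => simp
    | succ k ih =>
      have h1 := hE k
      have h2 := mul_le_mul_of_nonneg_left ih hq0
      rw [pow_succ]
      linarith
  set u : ℕ → ℝ := fun k => a * (q ^ k * (E 1 - s) + s + b) with hu
  have hlim : Tendsto u atTop (𝓝 (a * (s + b))) := by
    have h1 := tendsto_pow_atTop_nhds_zero_of_lt_one hq0 hq1
    have h2 := (((h1.mul_const (E 1 - s)).add_const s).add_const b).const_mul a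
    simpa using h2
  have hle : ∀ k, e (k + 1) ≤ u k := fun k =>
    (heE k).trans (mul_le_mul_of_nonneg_left (by linarith [hgeo k]) ha)
  have hlim' : Tendsto (fun k => u (k - 1)) atTop (𝓝 (a * (s + b))) :=
    hlim.comp (tendsto_sub_atTop_nat 1)
  have hev : e ≤ᶠ[atTop] fun k => u (k - 1) := by
    filter_upwards [eventually_ge_atTop 1] with k hk
    obtain ⟨j, rfl⟩ := Nat.exists_eq_add_of_le' hk
    exact hle j
  have hbdd : IsBoundedUnder (· ≤ ·) atTop e := hlim'.isBoundedUnder_le.mono_le hev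
  refine ⟨hbdd, ?_⟩
  rw [← hlim'.limsup_eq]
  exact limsup_le_limsup hev
    (isBoundedUnder_of ⟨0, he⟩ : IsBoundedUnder (· ≥ ·) atTop e).isCoboundedUnder_le
    hlim'.isBoundedUnder_le

/-! ### Signs of the constants. -/

section Constants

variable {dM : ℕ} {μ ε ρ : ℝ}

theorem zeta_nonneg (hμ : 0 < μ) (hε : 0 < ε) (hρ : 0 < ρ) (M : ℕ) : 0 ≤ zeta dM μ ρ M ε := by
  unfold zeta
  split_ifs
  · exact zero_le_one
  · exact mul_nonneg (zero_le_one.trans (one_le_omega hμ hε hρ)) (pow_nonneg lam_nonneg _)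

theorem xi_nonneg (hμ : 0 < μ) (hε : 0 < ε) (hρ : 0 < ρ) (M : ℕ) : 0 ≤ xi dM μ ρ M ε := by
  unfold xi
  split_ifs
  · exact le_rfl
  · have := mul_nonneg (zero_le_one.trans (one_le_omega (dM := dM) hμ hε hρ))
      (pow_nonneg (lam_nonneg (dM := dM) (μ := μ) (ρ := ρ) (ε := ε)) M)
    linarith

theorem one_le_zeta_add_xi (hμ : 0 < μ) (hε : 0 < ε) (hρ : 0 < ρ) (M : ℕ) :
    1 ≤ zeta dM μ ρ M ε + xi dM μ ρ M ε := by
  by_cases hM : M = 0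
  · simp [zeta, xi, hM]
  · have := zeta_nonneg (dM := dM) hμ hε hρ M
    simp only [zeta, xi, hM, if_false] at this ⊢
    linarith

theorem one_le_kappaBar (hμ : 0 < μ) (hε : 0 < ε) : 1 ≤ kappaBar dM μ ε := by
  unfold kappaBar
  have : 0 ≤ (dM : ℝ) / (μ * ε) := by positivity
  linarith

theorem eta1_nonneg (hμ : 0 < μ) (hε : 0 < ε) (hρ : 0 < ρ) (NP NC : ℕ) :
    0 ≤ eta1 dM μ ρ NP NC ε := by
  have h1 := zeta_nonneg (dM := dM) hμ hε hρ NC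
  have h2 := zeta_nonneg (dM := dM) hμ hε hρ NP
  have h3 := xi_nonneg (dM := dM) hμ hε hρ NP
  have h4 := one_le_kappaBar (dM := dM) hμ hε
  unfold eta1
  positivity

/-- Without correction steps `η₁ ≥ ζ(N_P) + ξ(N_P) ≥ 1`, since `κ̄ ≥ 1`. -/
theorem correction_ne_zero (hμ : 0 < μ) (hε : 0 < ε) (hρ : 0 < ρ) {NP NC : ℕ}
    (h : eta1 dM μ ρ NP NC ε < 1) : NC ≠ 0 := by
  rintro rfl
  have h1 := one_le_zeta_add_xi (dM := dM) hμ hε hρ NP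
  have h3 := xi_nonneg (dM := dM) hμ hε hρ NP
  have h4 := one_le_kappaBar (dM := dM) hμ hε
  unfold eta1 at h
  have h5 : zeta dM μ ρ 0 ε = 1 := if_pos rfl
  rw [h5, one_mul] at h
  have := mul_le_mul_of_nonneg_right h4 h3
  linarith

end Constants

theorem CostAssumption.bound_nonneg {V : Type*} [Nonempty V] {n : ℕ} {f : V → ℝ → Vec n → ℝ}
    {μ L C₀ : ℝ} (hf : CostAssumption f μ L C₀) : 0 ≤ C₀ :=
  (norm_nonneg _).trans (hf.mixed_bound (Classical.arbitrary V) 0 0 le_rfl)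

/-! ### Effect of time variation and prediction on primal points. -/

section Perturbation

variable {V : Type*} [Fintype V] [DecidableEq V] (G : SimpleGraph V) [DecidableRel G.Adj] {n : ℕ}
  {f : V → ℝ → Vec n → ℝ} {μ L C₀ : ℝ}

theorem norm_A_sub_le {x x' : NodeSpace V n} {a : ℝ} (ha : 0 ≤ a) (h : ∀ i, ‖x i - x' i‖ ≤ a) :
    ‖A G n x - A G n x'‖ ≤ Real.sqrt G.maxDegree * (Real.sqrt (Fintype.card V) * a) := by
  have h1 : ‖x - x'‖ ≤ Real.sqrt (Fintype.card V) * a := nodeSpace_norm_le ha h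
  have h2 := norm_sq_A_le G (x - x')
  rw [map_sub] at h2
  refine le_trans ?_ (mul_le_mul_of_nonneg_left h1 (Real.sqrt_nonneg _))
  refine abs_le_of_sq_le_sq' ?_ (by positivity) |>.2
  rwa [mul_pow, Real.sq_sqrt (Nat.cast_nonneg _)]

/-- Variation in time of the primal point assigned to a dual point. -/
theorem CostAssumption.norm_A_sub_le_of_eq [Nonempty V] (hf : CostAssumption f μ L C₀) (hμ : 0 < μ)
    {t t' Ts : ℝ} (ht : 0 ≤ t) (hTs : 0 < Ts) (htt : t' - t = Ts) {x x' : NodeSpace V n}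
    (h : totalGradient (fun i => f i t) x = totalGradient (fun i => f i t') x') :
    ‖A G n x - A G n x'‖ ≤
      Real.sqrt G.maxDegree * (Real.sqrt (Fintype.card V) * (C₀ * Ts / μ)) := by
  have hC := hf.bound_nonneg
  refine norm_A_sub_le G (by positivity) fun i => ?_
  have h1 : gradient (f i t) (x i) = gradient (f i t') (x' i) :=
    congrArg (fun y : NodeSpace V n => y i) h
  have h2 := (hf.mem_class i t ht).gradient_lipschitz.mul_norm_sub_le (x i) (x' i)
  have h3 := hf.norm_gradient_sub_le i (x' i) ht (show 0 ≤ t' by linarith)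
  rw [h1] at h2
  rw [htt, abs_of_pos hTs] at h3
  rw [le_div_iff₀ hμ]
  linarith

/-- Effect of the drift term of the predicted cost on the primal point. -/
theorem CostAssumption.norm_A_sub_le_of_predicted [Nonempty V] (hf : CostAssumption f μ L C₀)
    (hμ : 0 < μ) {t Ts : ℝ} (ht : 0 ≤ t) (hTs : 0 < Ts) {x y : NodeSpace V n}
    (h : totalGradient (fun i => predictedCost (f i) t Ts (x i)) y
      = totalGradient (fun i => f i t) x) :
    ‖A G n y - A G n x‖ ≤
      Real.sqrt G.maxDegree * (Real.sqrt (Fintype.card V) * (C₀ * Ts / μ)) := by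
  have hC := hf.bound_nonneg
  refine norm_A_sub_le G (by positivity) fun i => ?_
  have h1 : gradient (predictedCost (f i) t Ts (x i)) (y i) = gradient (f i t) (x i) :=
    congrArg (fun y : NodeSpace V n => y i) h
  have h2 := (predictedCost_stronglyMonotone (hf.mem_class i t ht) hμ (hf.hessian_exists i t ht)
    Ts (x i)).mul_norm_sub_le (y i) (x i)
  rw [h1, gradient_predictedCost, sub_self, map_zero, add_zero, sub_add_cancel_left, norm_neg,
    norm_smul, Real.norm_of_nonneg hTs.le] at h2
  have h3 := mul_le_mul_of_nonneg_left (hf.mixed_bound i (x i) t ht) hTs.le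
  rw [le_div_iff₀ hμ]
  linarith

end Perturbation

/-! ### The dual error recursion of the algorithm. -/

section Tracking

variable {V : Type*} [Fintype V] [DecidableEq V] {G : SimpleGraph V} [DecidableRel G.Adj] {n : ℕ}
  {f : V → ℝ → Vec n → ℝ} {μ L C₀ : ℝ}

theorem IsADMMOutput.exists_resolvents {φ : V → Vec n → ℝ} {ε ρ : ℝ} {M : ℕ}
    {z₀ zOut : EdgeSpace G n} {xOut : NodeSpace V n} (hφ : ∀ i, Differentiable ℝ (φ i))
    (hε : 0 < ε) (hρ : 0 < ρ) (h : IsADMMOutput G φ ε ρ M z₀ xOut zOut) :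
    ∃ (z w : ℕ → EdgeSpace G n) (x : ℕ → NodeSpace V n), z 0 = z₀ ∧
      (∀ ℓ, IsResolvent (totalGradient φ) (A G n) ε ρ (z ℓ) (x ℓ) (w ℓ)) ∧
      (∀ ℓ, z (ℓ + 1) = -P G n ((2 : ℝ) • w ℓ - z ℓ)) ∧
      xOut = x M ∧ zOut = z M ∧ w M = dualVariable G ε ρ zOut xOut := by
  obtain ⟨x, z, h0, hx, hz, hxM, hzM⟩ := h
  refine ⟨z, fun ℓ => dualVariable G ε ρ (z ℓ) (x ℓ), x, h0,
    fun ℓ => (hx ℓ).isResolvent G hφ hε hρ, fun ℓ => ?_, hxM, hzM, by rw [hxM, hzM]⟩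
  rw [hz, auxUpdate_eq]

/-- The recursion for the distance to the regularized dual solutions. -/
theorem CostAssumption.dual_error_le [Nonempty V] (hf : CostAssumption f μ L C₀) (hμ : 0 < μ)
    {s : ℝ} (hs0 : 0 < s)
    (hs : ∀ w : EdgeSpace G n, P G n w = -w →
      (∀ v, P G n v = -v → ContinuousLinearMap.adjoint (A G n) v = 0 → inner ℝ w v = 0) →
      s * ‖w‖ ^ 2 ≤ ‖ContinuousLinearMap.adjoint (A G n) w‖ ^ 2)
    {ε ρ t t' Ts : ℝ} {NP NC : ℕ} (hε : 0 < ε) (hρ : 0 < ρ) (hNC : NC ≠ 0)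
    (ht : 0 ≤ t) (hTs : 0 < Ts) (htt : t' - t = Ts)
    (hεm : 2 * Real.sqrt (Fintype.card V) * ε ≤ μ * s / max L μ ^ 2)
    (hεβ : 2 * Real.sqrt (Fintype.card V) * ε ≤ G.maxDegree / μ)
    {ws ws' z z' zhat : EdgeSpace G n} {x x' xhat : NodeSpace V n}
    (hws : IsDualSolution G (fun i => f i t) ε ws)
    (hws' : IsDualSolution G (fun i => f i t') ε ws')
    (hk : IsResolvent (totalGradient fun i => f i t) (A G n) ε ρ z x (dualVariable G ε ρ z x))
    (hpred : IsADMMOutput G (fun i => predictedCost (f i) t Ts (x i)) ε ρ NP z xhat zhat)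
    (hcorr : IsADMMOutput G (fun i => f i t') ε ρ NC zhat x' z') :
    ‖dualVariable G ε ρ z' x' - ws'‖ ≤ eta1 G.maxDegree μ ρ NP NC ε * ‖dualVariable G ε ρ z x - ws‖
      + eta0 G.maxDegree μ C₀ Ts ρ NP NC ε := by
  have ht' : 0 ≤ t' := by linarith
  have hmax : 0 < max L μ := lt_max_of_lt_right hμ
  have hC := hf.bound_nonneg
  have hN : 1 ≤ Real.sqrt (Fintype.card V) := by
    rw [Real.one_le_sqrt]
    exact_mod_cast Fintype.card_pos
  obtain ⟨xs, hsad⟩ := hws.exists_isSaddle hμ fun i => hf.mem_class i t ht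
  obtain ⟨xs', hsad'⟩ := hws'.exists_isSaddle hμ fun i => hf.mem_class i t' ht'
  obtain ⟨zp, wp, xp, hzp0, hp, hzp, -, rfl, -⟩ := hpred.exists_resolvents
    (fun i v => (hasGradientAt_predictedCost (f i) t Ts (x i) v).differentiableAt) hε hρ
  obtain ⟨zc, wc, xc, hzc0, hc, hzc, -, -, hwc⟩ := hcorr.exists_resolvents
    (fun i => (hf.mem_class i t' ht').differentiable) hε hρ
  -- Here `c` is the constant of `η₀` and `R = √N ε` carries the surplus factor `√N`; their product
  -- is the actual perturbation bound.
  have hR : Real.sqrt (Fintype.card V) * ε * (C0Bar G.maxDegree μ C₀ * Ts / ε)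
      = Real.sqrt G.maxDegree * (Real.sqrt (Fintype.card V) * (C₀ * Ts / μ)) := by
    unfold C0Bar; field_simp
  have key := tracking_error_le (dM := G.maxDegree) (s := s)
    (R := Real.sqrt (Fintype.card V) * ε) (c := C0Bar G.maxDegree μ C₀ * Ts / ε)
    (P_isSymmetricInvolution G)
    (totalGradient_stronglyMonotone hmax.le fun i => (hf.mem_class i t ht).gradient_lipschitz)
    (totalGradient_stronglyMonotone hmax.le fun i => (hf.mem_class i t' ht').gradient_lipschitz)
    (totalGradient_stronglyMonotone hmax.le fun i => predictedCost_stronglyMonotone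
      (hf.mem_class i t ht) hμ (hf.hessian_exists i t ht) Ts (x i))
    hμ hmax hε hρ hs0.le (by unfold C0Bar; positivity) (norm_sq_A_le G) hs (by linarith)
    (by linarith) (by nlinarith)
    (fun y y' h => (hf.norm_A_sub_le_of_eq G hμ ht hTs htt h).trans_eq hR.symm) hk
    (fun y h => (hf.norm_A_sub_le_of_predicted G hμ ht hTs h).trans_eq hR.symm) hsad hsad'
    hp hzp hzp0 NP hc hzc hzc0 hNC
  rw [hwc] at key
  refine key.trans_eq ?_
  unfold eta1 eta0 muBar
  ring

end Tracking

end PCADMM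

/-! ### Choice of constants and passage to the limsup. -/

theorem corollary2 {V : Type*} [Fintype V] [DecidableEq V] (G : SimpleGraph V)
    [DecidableRel G.Adj] (hG : G.Connected) (n : ℕ)
    (f : V → ℝ → PCADMM.Vec n → ℝ) (μ L C₀ : ℝ) (hμ : 0 < μ)
    (hf : PCADMM.CostAssumption f μ L C₀) :
    ∃ ψ₀ : ℝ, 0 < ψ₀ ∧ ∃ ε₀ : ℝ, 0 < ε₀ ∧
      ∀ (Ts : ℝ) (t : ℕ → ℝ), 0 < Ts → 0 ≤ t 0 → (∀ k, t (k + 1) - t k = Ts) →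
      ∀ xstar : ℕ → PCADMM.NodeSpace V n,
        (∀ k, PCADMM.IsPrimalSolution G (fun i => f i (t k)) (xstar k)) →
      ∀ ε : ℝ, 0 < ε → ε < ε₀ →
      ∀ (C : ℝ) (wstar wstarReg : ℕ → PCADMM.EdgeSpace G n),
        (∀ k, PCADMM.IsDualSolution G (fun i => f i (t k)) 0 (wstar k)) →
        (∀ k, PCADMM.IsDualSolution G (fun i => f i (t k)) ε (wstarReg k)) →
        (∀ k, max ‖wstar k‖ ‖wstarReg k‖ ≤ C) →
      ∀ (ρ : ℝ) (NP NC : ℕ), 0 < ρ →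
        PCADMM.eta1 G.maxDegree μ ρ NP NC ε < 1 →
      ∀ (x : ℕ → PCADMM.NodeSpace V n) (z : ℕ → PCADMM.EdgeSpace G n),
        PCADMM.IsPredictionCorrectionRun G f t Ts ε ρ NP NC x z →
      IsBoundedUnder (· ≤ ·) atTop (fun k => ‖x k - xstar k‖) ∧
      limsup (fun k => ‖x k - xstar k‖) atTop ≤
        ‖PCADMM.A G n‖ / μ *
          (PCADMM.eta0 G.maxDegree μ C₀ Ts ρ NP NC ε / (1 - PCADMM.eta1 G.maxDegree μ ρ NP NC ε)
            + C * (1 + ψ₀ * ε)) := by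
  have : Nonempty V := hG.nonempty
  obtain ⟨s, hs0, hs⟩ := PCADMM.exists_mul_norm_sq_le_adjoint G n
  have hmax : 0 < max L μ := lt_max_of_lt_right hμ
  have hN : 0 < Real.sqrt (Fintype.card V) := Real.sqrt_pos.2 (by exact_mod_cast Fintype.card_pos)
  set m : ℝ := μ * s / max L μ ^ 2 with hm
  have hm0 : 0 < m := by positivity
  -- For degree `0` any positive value serves; it only keeps `ε₀` positive.
  set β : ℝ := if G.maxDegree = 0 then 1 else (G.maxDegree : ℝ) / μ with hβ
  have hβ0 : 0 < β := by
    rw [hβ]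
    split_ifs with h
    · exact one_pos
    · have : 0 < G.maxDegree := Nat.pos_of_ne_zero h
      positivity
  refine ⟨1, one_pos, min m β / (2 * Real.sqrt (Fintype.card V)), by positivity, ?_⟩
  intro Ts t hTs ht0 hts xstar hxstar ε hε hε₀ C wstar wstarReg hw hwReg hC ρ NP NC hρ hη x z hrun
  rw [lt_div_iff₀ (by positivity)] at hε₀
  have hεm : 2 * Real.sqrt (Fintype.card V) * ε ≤ m := by
    have := min_le_left m β
    linarith
  have hεβ : 2 * Real.sqrt (Fintype.card V) * ε ≤ β := by
    have := min_le_right m β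
    linarith
  have ht : ∀ k, 0 ≤ t k := fun k => by
    induction k with
    | zero => exact ht0
    | succ k ih => linarith [hts k]
  have hNC := PCADMM.correction_ne_zero hμ hε hρ hη
  have hC0 : 0 ≤ C := (norm_nonneg _).trans ((le_max_left _ _).trans (hC 0))
  set wk : ℕ → PCADMM.EdgeSpace G n := fun k => PCADMM.dualVariable G ε ρ (z k) (x k) with hwk
  have hF : ∀ k, PCADMM.StronglyMonotoneLipschitz μ (max L μ)
      (PCADMM.totalGradient fun i => f i (t k)) := fun k =>
    PCADMM.totalGradient_stronglyMonotone hmax.le fun i =>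
      (hf.mem_class i (t k) (ht k)).gradient_lipschitz
  -- Only from index `1` on: the initial `x 0` and `z 0` are unrelated.
  have hres : ∀ k, PCADMM.IsResolvent (PCADMM.totalGradient fun i => f i (t (k + 1)))
      (PCADMM.A G n) ε ρ (z (k + 1)) (x (k + 1)) (wk (k + 1)) := fun k => by
    obtain ⟨xhat, zhat, -, hcorr⟩ := hrun k
    obtain ⟨zc, wc, xc, -, hc, -, hxM, hzM, hwc⟩ := hcorr.exists_resolvents
      (fun i => (hf.mem_class i _ (ht (k + 1))).differentiable) hε hρ
    have := hc NC
    rwa [hwc, ← hxM, ← hzM] at this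
  have herr : ∀ k, ‖x (k + 1) - xstar (k + 1)‖ ≤
      ‖PCADMM.A G n‖ / μ * (‖wk (k + 1) - wstarReg (k + 1)‖ + C) := fun k => by
    have hφ := fun i => hf.mem_class i _ (ht (k + 1))
    obtain ⟨xs, hsad⟩ := (hw (k + 1)).exists_isSaddle hμ hφ
    obtain ⟨xr, hsadr⟩ := (hwReg (k + 1)).exists_isSaddle hμ hφ
    rw [(hxstar (k + 1)).eq_of_isSaddle hμ hφ hsad]
    refine ((hF (k + 1)).norm_sub_le_of_adjoint hμ (hres k).stationary hsad.stationary).trans ?_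
    refine mul_le_mul_of_nonneg_left ?_ (by positivity)
    have h1 := PCADMM.norm_sub_le_of_isSaddle (hF (k + 1)) hμ hε hsadr hsad
    have h2 := (le_max_left _ _).trans (hC (k + 1))
    have h3 := norm_sub_le_norm_sub_add_norm_sub (wk (k + 1)) (wstarReg (k + 1)) (wstar (k + 1))
    linarith
  -- For maximum degree `0`, `A = 0`, and the primal error vanishes from index `1` on.
  by_cases hd : G.maxDegree = 0
  · have hA0 : ‖PCADMM.A G n‖ = 0 := by
      have : PCADMM.A G n = 0 := by
        ext1 y
        have h1 := PCADMM.norm_sq_A_le G y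
        rw [hd, Nat.cast_zero, zero_mul] at h1
        have h2 : ‖PCADMM.A G n y‖ ^ 2 = 0 := le_antisymm h1 (sq_nonneg _)
        simpa using h2
      rw [this, norm_zero]
    have h1 := PCADMM.limsup_le_of_affine_recursion (e := fun k => ‖x k - xstar k‖)
      (E := fun _ => 0) (a := 0) (b := 0) (q := 0) (r := 0) (fun k => norm_nonneg _) le_rfl le_rfl
      one_pos (fun k => (herr k).trans_eq (by rw [hA0]; simp)) (fun k => by simp)
    refine ⟨h1.1, h1.2.trans_eq ?_⟩
    rw [hA0]; simp
  · rw [hβ, if_neg hd] at hεβ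
    have h1 := PCADMM.limsup_le_of_affine_recursion (e := fun k => ‖x k - xstar k‖)
      (E := fun k => ‖wk k - wstarReg k‖) (a := ‖PCADMM.A G n‖ / μ) (b := C)
      (fun k => norm_nonneg _) (by positivity) (PCADMM.eta1_nonneg hμ hε hρ NP NC) hη herr
      (fun k => by
        obtain ⟨xhat, zhat, hpred, hcorr⟩ := hrun (k + 1)
        exact hf.dual_error_le hμ hs0 hs hε hρ hNC (ht (k + 1)) hTs (hts (k + 1)) hεm hεβ
          (hwReg (k + 1)) (hwReg (k + 2)) (hres k) hpred hcorr)
    refine ⟨h1.1, h1.2.trans (mul_le_mul_of_nonneg_left ?_ (by positivity))⟩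
    have := mul_nonneg hC0 hε.le
    linarith
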